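/- Conventions. A discrete Borel groupoid $\mathcal G$ with unit space $X$ is a groupoid with a standard Borel structure on its set of arrows, whose structure maps are Borel, whose unit space $X=\mathcal G^{(0)}$ is a Borel subset, and whose source and target maps $s,t:\mathcal G\to X$ are countable-to-one. For a Borel probability measure $\mu$ on $X$ put $\mu_s(A)=\int_X|\{g\in A: s(g)=x\}|\,d\mu(x)$ and $\mu_t(A)=\int_X|\{g\in A: t(g)=x\}|\,d\mu(x)$ for Borel $A\subseteq\mathcal G$. $\mathcal G$ is a discrete measured groupoid with unit space $(X,\mu)$ if $\mu_s$ and $\mu_t$ have the same null sets. Its associated equivalence relation is $\mathcal R_{\mathcal G}=\{(t(g),s(g)): g\in\mathcal G\}$. Two such groupoids with unit spaces $(X_1,\mu_1)$, $(X_2,\mu_2)$ are isomorphic if, after restriction to conull Borel subsets of the unit spaces, there is a Borel groupoid isomorphism between them that preserves null sets in both directions. A countable measured equivalence relation $\mathcal R$ on a standard probability space $(X,\mu)$ is an equivalence relation on $X$ that is a Borel subset of $X\times X$, has countable classes, and is such that the saturation $\mathcal R(E)$ of every null Borel set $E$ is null; it is regarded as a groupoid with $s(x,y)=y$, $t(x,y)=x$.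 It is ergodic if every Borel set $E\subseteq X$ with $\mathcal R(E)=E$ up to a null set is null or conull. An ergodic $\mathcal R$ is of type I if it is isomorphic (as a measured groupoid) to the complete equivalence relation on a non-empty finite or countably infinite set with counting measure. The transformation groupoid of a nonsingular Borel action of a countable discrete group $\Gamma$ on a standard probability space $(Y,\nu)$ is $Y\times\Gamma$ with $s(y,\gamma)=y$, $t(y,\gamma)=\gamma y$, $(\gamma y,\delta)(y,\gamma)=(y,\delta\gamma)$. A discrete measured groupoid whose associated equivalence relation is ergodic is called genuine if it is isomorphic neither to a countable measured equivalence relation on a standard probability space nor to the transformation groupoid of a nonsingular action of a countable discrete group on a standard probability space. A discrete measured groupoid $\mathcal G$ is called icc if, for every non-null Borel set $E\subseteq\{g\in\mathcal G: s(g)=t(g)\}$ whose conjugacy class $\Omega_E=\{ghg^{-1}: h\in E,\ g\in\mathcal G,\ s(g)=t(h)\}$ has finite $\mu_s$-measure, one has $E\subseteq\mathcal G^{(0)}$ up to a null set. (On arrows with $s(g)=t(g)$, $\mu_s=\mu_t$.) Theorem. Let $\mathcal R$ be an ergodic countable measured equivalence relation on a standard probability space $(X,\mu)$. Then the following are equivalent: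 1. $\mu$ is diffuse, i.e. $\mu(\{x\})=0$ for all $x\in X$; 1'. $\mathcal R$ is not of type I; 2. there exists a genuine discrete measured groupoid $\mathcal G$ with unit space $(X,\mu)$ and $\mathcal R_{\mathcal G}=\mathcal R$; 3. there exists a genuine icc discrete measured groupoid $\mathcal G$ with unit space $(X,\mu)$ and $\mathcal R_{\mathcal G}=\mathcal R$. -/

import Mathlib

open MeasureTheory
open scoped ENNReal

universe u

/-- A discrete Borel groupoid with unit space `X`: a groupoid whose set of arrows is a standard
Borel space, whose structure maps are Borel, and whose source and target maps are
countable-to-one. Units are given by the section `one`, which is a Borel embedding of `X`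
(its left inverse `s` is Borel). The product `mul g h` is defined when `s g = t h`. -/
structure DiscreteBorelGroupoid (X : Type u) [MeasurableSpace X] where
  /-- the arrows -/
  Arrow : Type u
  [measurableSpace : MeasurableSpace Arrow]
  [standardBorelSpace : StandardBorelSpace Arrow]
  /-- source -/
  s : Arrow → X
  /-- target -/
  t : Arrow → X
  /-- the unit at a point -/
  one : X → Arrow
  /-- inverse -/
  inv : Arrow → Arrow
  /-- product of composable arrows -/
  mul : (g h : Arrow) → s g = t h → Arrow
  s_one : ∀ x, s (one x) = x
  t_one : ∀ x, t (one x) = x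
  s_inv : ∀ g, s (inv g) = t g
  t_inv : ∀ g, t (inv g) = s g
  s_mul : ∀ g h hgh, s (mul g h hgh) = s h
  t_mul : ∀ g h hgh, t (mul g h hgh) = t g
  mul_assoc : ∀ g h k (hgh : s g = t h) (hhk : s h = t k),
    mul (mul g h hgh) k ((s_mul g h hgh).trans hhk) =
      mul g (mul h k hhk) (hgh.trans (t_mul h k hhk).symm)
  one_mul : ∀ g, mul (one (t g)) g (s_one (t g)) = g
  mul_one : ∀ g, mul g (one (s g)) (t_one (s g)).symm = g
  inv_mul : ∀ g, mul (inv g) g (s_inv g) = one (s g)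
  mul_inv : ∀ g, mul g (inv g) (t_inv g).symm = one (t g)
  measurable_s : Measurable s
  measurable_t : Measurable t
  measurable_one : Measurable one
  measurable_inv : Measurable inv
  measurable_mul :
    Measurable fun p : {p : Arrow × Arrow // s p.1 = t p.2} => mul p.1.1 p.1.2 p.2
  countable_s : ∀ x, (s ⁻¹' {x}).Countable
  countable_t : ∀ x, (t ⁻¹' {x}).Countable

attribute [instance] DiscreteBorelGroupoid.measurableSpace
  DiscreteBorelGroupoid.standardBorelSpace

/-- A countable Borel equivalence relation: its graph is Borel and its classes are countable. -/
structure IsCountableBorelRel {X : Type u} [MeasurableSpace X] (R : Setoid X) : Prop where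
  measurableSet_graph : MeasurableSet {p : X × X | R p.1 p.2}
  countable_class : ∀ x, {y | R y x}.Countable

/-- The saturation `R(E)` of a set. -/
def relSaturation {X : Type u} (R : Setoid X) (E : Set X) : Set X :=
  {y | ∃ x ∈ E, R y x}

/-- A nonsingular countable Borel equivalence relation on `(X, μ)`: saturations of null sets
are null. -/
structure IsCountableMeasuredRel {X : Type u} [MeasurableSpace X] (R : Setoid X)
    (μ : Measure X) : Prop extends IsCountableBorelRel R where
  saturation_null : ∀ E, MeasurableSet E → μ E = 0 → μ (relSaturation R E) = 0

/-- Ergodicity: every Borel set that is invariant up to a null set is null or conull. -/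
def IsErgodicRel {X : Type u} [MeasurableSpace X] (R : Setoid X) (μ : Measure X) : Prop :=
  ∀ E, MeasurableSet E → relSaturation R E =ᵐ[μ] E → μ E = 0 ∨ μ Eᶜ = 0

namespace DiscreteBorelGroupoid

variable {X : Type u} [MeasurableSpace X]

/-- The associated equivalence relation `{(t g, s g) | g}` on the unit space. -/
def orbitRel (𝒢 : DiscreteBorelGroupoid X) : Setoid X where
  r x y := ∃ g, 𝒢.t g = x ∧ 𝒢.s g = y
  iseqv :=
    { refl := fun x => ⟨𝒢.one x, 𝒢.t_one x, 𝒢.s_one x⟩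
      symm := by
        rintro x y ⟨g, rfl, rfl⟩
        exact ⟨𝒢.inv g, 𝒢.t_inv g, 𝒢.s_inv g⟩
      trans := by
        rintro x y z ⟨g, rfl, hg⟩ ⟨h, hh, rfl⟩
        exact ⟨𝒢.mul g h (hg.trans hh.symm), 𝒢.t_mul _ _ _, 𝒢.s_mul _ _ _⟩ }

/-- `μ_s(A) = ∫ |{g ∈ A : s g = x}| dμ(x)`, to be evaluated on Borel sets `A`. -/
noncomputable def sMeas (𝒢 : DiscreteBorelGroupoid X) (μ : Measure X) (A : Set 𝒢.Arrow) : ℝ≥0∞ :=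
  ∫⁻ x, ({g ∈ A | 𝒢.s g = x}.encard : ℝ≥0∞) ∂μ

/-- `μ_t(A) = ∫ |{g ∈ A : t g = x}| dμ(x)`, to be evaluated on Borel sets `A`. -/
noncomputable def tMeas (𝒢 : DiscreteBorelGroupoid X) (μ : Measure X) (A : Set 𝒢.Arrow) : ℝ≥0∞ :=
  ∫⁻ x, ({g ∈ A | 𝒢.t g = x}.encard : ℝ≥0∞) ∂μ

theorem measurable_composable_restrict (𝒢 : DiscreteBorelGroupoid X) (A : Set X) :
    Measurable fun p : {p : {g : 𝒢.Arrow // 𝒢.s g ∈ A ∧ 𝒢.t g ∈ A} ×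
        {g : 𝒢.Arrow // 𝒢.s g ∈ A ∧ 𝒢.t g ∈ A} //
        (⟨𝒢.s p.1.1, p.1.2.1⟩ : A) = ⟨𝒢.t p.2.1, p.2.2.2⟩} =>
      (⟨(p.1.1.1, p.1.2.1), congrArg Subtype.val p.2⟩ :
        {p : 𝒢.Arrow × 𝒢.Arrow // 𝒢.s p.1 = 𝒢.t p.2}) :=
  Measurable.subtype_mk
    ((measurable_subtype_coe.comp (measurable_fst.comp measurable_subtype_coe)).prodMk
      (measurable_subtype_coe.comp (measurable_snd.comp measurable_subtype_coe)))

/-- The restriction `{g | s g ∈ A, t g ∈ A}` of a groupoid to a Borel set `A` of units. -/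
def restrict (𝒢 : DiscreteBorelGroupoid X) (A : Set X) (hA : MeasurableSet A) :
    DiscreteBorelGroupoid A where
  Arrow := {g : 𝒢.Arrow // 𝒢.s g ∈ A ∧ 𝒢.t g ∈ A}
  standardBorelSpace :=
    ((𝒢.measurable_s hA).inter (𝒢.measurable_t hA)).standardBorel
  s g := ⟨𝒢.s g.1, g.2.1⟩
  t g := ⟨𝒢.t g.1, g.2.2⟩
  one x := ⟨𝒢.one x.1, (𝒢.s_one x.1).symm ▸ x.2, (𝒢.t_one x.1).symm ▸ x.2⟩
  inv g := ⟨𝒢.inv g.1, (𝒢.s_inv g.1).symm ▸ g.2.2, (𝒢.t_inv g.1).symm ▸ g.2.1⟩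
  mul g h hgh := ⟨𝒢.mul g.1 h.1 (congrArg Subtype.val hgh),
    (𝒢.s_mul g.1 h.1 (congrArg Subtype.val hgh)).symm ▸ h.2.1,
    (𝒢.t_mul g.1 h.1 (congrArg Subtype.val hgh)).symm ▸ g.2.2⟩
  s_one x := Subtype.ext (𝒢.s_one x.1)
  t_one x := Subtype.ext (𝒢.t_one x.1)
  s_inv g := Subtype.ext (𝒢.s_inv g.1)
  t_inv g := Subtype.ext (𝒢.t_inv g.1)
  s_mul _ _ _ := Subtype.ext (𝒢.s_mul _ _ _)
  t_mul _ _ _ := Subtype.ext (𝒢.t_mul _ _ _)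
  mul_assoc _ _ _ _ _ := Subtype.ext (𝒢.mul_assoc _ _ _ _ _)
  one_mul g := Subtype.ext (𝒢.one_mul g.1)
  mul_one g := Subtype.ext (𝒢.mul_one g.1)
  inv_mul g := Subtype.ext (𝒢.inv_mul g.1)
  mul_inv g := Subtype.ext (𝒢.mul_inv g.1)
  measurable_s := (𝒢.measurable_s.comp measurable_subtype_coe).subtype_mk
  measurable_t := (𝒢.measurable_t.comp measurable_subtype_coe).subtype_mk
  measurable_one := (𝒢.measurable_one.comp measurable_subtype_coe).subtype_mk
  measurable_inv := (𝒢.measurable_inv.comp measurable_subtype_coe).subtype_mk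
  measurable_mul := by
    have h := 𝒢.measurable_mul.comp (measurable_composable_restrict 𝒢 A)
    exact h.subtype_mk
  countable_s x := by
    refine ((𝒢.countable_s x.1).preimage Subtype.val_injective).mono ?_
    intro g hg
    exact congrArg Subtype.val hg
  countable_t x := by
    refine ((𝒢.countable_t x.1).preimage Subtype.val_injective).mono ?_
    intro g hg
    exact congrArg Subtype.val hg

/-- A Borel isomorphism of discrete Borel groupoids: a Borel isomorphism of the arrow spaces that
preserves and reflects composability, and preserves products and inverses. -/
structure BorelIso {X Y : Type u} [MeasurableSpace X] [MeasurableSpace Y]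
    (𝒢 : DiscreteBorelGroupoid X) (ℋ : DiscreteBorelGroupoid Y) where
  /-- the bijection of arrows -/
  toEquiv : 𝒢.Arrow ≃ᵐ ℋ.Arrow
  composable_iff : ∀ g h, 𝒢.s g = 𝒢.t h ↔ ℋ.s (toEquiv g) = ℋ.t (toEquiv h)
  map_mul : ∀ g h (hgh : 𝒢.s g = 𝒢.t h),
    toEquiv (𝒢.mul g h hgh) =
      ℋ.mul (toEquiv g) (toEquiv h) ((composable_iff g h).1 hgh)
  map_inv : ∀ g, toEquiv (𝒢.inv g) = ℋ.inv (toEquiv g)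

/-- Isomorphism of discrete measured groupoids with unit spaces `(X, μ)` and `(Y, ν)`: a
nonsingular Borel isomorphism, defined after restriction to conull Borel sets of units. -/
def Isomorphic {X Y : Type u} [MeasurableSpace X] [MeasurableSpace Y]
    (𝒢 : DiscreteBorelGroupoid X) (μ : Measure X)
    (ℋ : DiscreteBorelGroupoid Y) (ν : Measure Y) : Prop :=
  ∃ (A : Set X) (hA : MeasurableSet A) (B : Set Y) (hB : MeasurableSet B),
    μ Aᶜ = 0 ∧ ν Bᶜ = 0 ∧
    ∃ φ : BorelIso (𝒢.restrict A hA) (ℋ.restrict B hB),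
      ∀ E, MeasurableSet E →
        ((𝒢.restrict A hA).sMeas (μ.comap Subtype.val) E = 0 ↔
          (ℋ.restrict B hB).sMeas (ν.comap Subtype.val) (φ.toEquiv '' E) = 0)

/-- A countable Borel equivalence relation as a groupoid: the arrows are the pairs `(x, y)` with
`x ∼ y`, with target `x` and source `y`, and `(x, y) (y, z) = (x, z)`. -/
def ofRel {X : Type u} [MeasurableSpace X] [StandardBorelSpace X] (R : Setoid X)
    (hR : IsCountableBorelRel R) : DiscreteBorelGroupoid X where
  Arrow := {p : X × X // R p.1 p.2}
  standardBorelSpace := hR.measurableSet_graph.standardBorel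
  s p := p.1.2
  t p := p.1.1
  one x := ⟨(x, x), R.refl x⟩
  inv p := ⟨(p.1.2, p.1.1), R.symm p.2⟩
  mul p q hpq := ⟨(p.1.1, q.1.2), R.trans p.2 (by rw [hpq]; exact q.2)⟩
  s_one _ := rfl
  t_one _ := rfl
  s_inv _ := rfl
  t_inv _ := rfl
  s_mul _ _ _ := rfl
  t_mul _ _ _ := rfl
  mul_assoc _ _ _ _ _ := rfl
  one_mul _ := rfl
  mul_one _ := rfl
  inv_mul _ := rfl
  mul_inv _ := rfl
  measurable_s := by fun_prop
  measurable_t := by fun_prop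
  measurable_one := Measurable.subtype_mk (by fun_prop)
  measurable_inv := Measurable.subtype_mk (by fun_prop)
  measurable_mul := Measurable.subtype_mk (by fun_prop)
  countable_s x := by
    refine Set.Countable.mono (s₂ := (fun p : {p : X × X // R p.1 p.2} => p.1.1) ⁻¹'
      {y | R y x} ∩ {p | p.1.2 = x}) ?_ ?_
    · rintro ⟨⟨a, b⟩, h⟩ (rfl : b = x)
      exact ⟨h, rfl⟩
    · refine Set.MapsTo.countable_of_injOn (f := fun p : {p : X × X // R p.1 p.2} => p.1.1)
        (t := {y | R y x}) (fun p hp => hp.1) ?_ (hR.countable_class x)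
      rintro ⟨⟨a, b⟩, h⟩ ⟨_, hb⟩ ⟨⟨a', b'⟩, h'⟩ ⟨_, hb'⟩ hab
      change b = x at hb
      change b' = x at hb'
      change a = a' at hab
      subst hb hb' hab
      rfl
  countable_t x := by
    refine Set.MapsTo.countable_of_injOn (f := fun p : {p : X × X // R p.1 p.2} => p.1.2)
      (t := {y | R y x}) ?_ ?_ (hR.countable_class x)
    · rintro ⟨⟨a, b⟩, h⟩ (rfl : a = x)
      exact R.symm h
    · rintro ⟨⟨a, b⟩, h⟩ (hb : a = x) ⟨⟨a', b'⟩, h'⟩ (hb' : a' = x) (hab : b = b')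
      subst hb hb' hab
      rfl

/-- The transformation groupoid of a Borel action of a countable discrete group `Γ` on `X`: the
arrows are the pairs `(x, γ)`, with source `x` and target `γ • x`, and
`(γ • x, δ) (x, γ) = (x, δ * γ)`. -/
def transformation (Γ : Type u) [Group Γ] [Countable Γ] [MeasurableSpace Γ]
    [DiscreteMeasurableSpace Γ] (X : Type u) [MeasurableSpace X] [StandardBorelSpace X]
    [MulAction Γ X] [MeasurableConstSMul Γ X] : DiscreteBorelGroupoid X where
  Arrow := X × Γ
  s p := p.1
  t p := p.2 • p.1
  one x := (x, 1)
  inv p := (p.2 • p.1, p.2⁻¹)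
  mul p q _ := (q.1, p.2 * q.2)
  s_one _ := rfl
  t_one x := one_smul Γ x
  s_inv _ := rfl
  t_inv p := inv_smul_smul p.2 p.1
  s_mul _ _ _ := rfl
  t_mul p q h := by
    change p.1 = q.2 • q.1 at h
    change (p.2 * q.2) • q.1 = p.2 • p.1
    rw [h, mul_smul]
  mul_assoc p q r _ _ := Prod.ext rfl (_root_.mul_assoc p.2 q.2 r.2)
  one_mul p := Prod.ext rfl (_root_.one_mul p.2)
  mul_one p := Prod.ext rfl (_root_.mul_one p.2)
  inv_mul p := Prod.ext rfl (inv_mul_cancel p.2)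
  mul_inv p := Prod.ext rfl (mul_inv_cancel p.2)
  measurable_s := measurable_fst
  measurable_t := measurable_from_prod_countable_left fun γ => measurable_const_smul γ
  measurable_one := by fun_prop
  measurable_inv := by
    refine Measurable.prodMk ?_ ((measurable_of_countable (fun γ : Γ => γ⁻¹)).comp measurable_snd)
    exact measurable_from_prod_countable_left fun γ => measurable_const_smul γ
  measurable_mul := by
    refine Measurable.prodMk (by fun_prop) ?_
    exact (measurable_of_countable (fun q : Γ × Γ => q.1 * q.2)).comp
      ((measurable_snd.comp (measurable_fst.comp measurable_subtype_coe)).prodMk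
        (measurable_snd.comp (measurable_snd.comp measurable_subtype_coe)))
  countable_s x := by
    refine (Set.countable_range fun γ : Γ => (x, γ)).mono ?_
    rintro ⟨y, γ⟩ (rfl : y = x)
    exact ⟨γ, rfl⟩
  countable_t x := by
    refine (Set.countable_range fun γ : Γ => (γ⁻¹ • x, γ)).mono ?_
    rintro ⟨y, γ⟩ (rfl : γ • y = x)
    exact ⟨γ, by simp⟩

/-- `𝒢` is isomorphic to (the groupoid of) a countable measured equivalence relation on some
standard probability space. -/
def IsIsoToRel (𝒢 : DiscreteBorelGroupoid X) (μ : Measure X) : Prop :=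
  ∃ (Y : Type u) (_ : MeasurableSpace Y) (_ : StandardBorelSpace Y) (ν : Measure Y)
    (_ : IsProbabilityMeasure ν) (S : Setoid Y) (hS : IsCountableMeasuredRel S ν),
    Isomorphic 𝒢 μ (ofRel S hS.toIsCountableBorelRel) ν

/-- `𝒢` is isomorphic to the transformation groupoid of a nonsingular action of some countable
discrete group on some standard probability space. -/
def IsIsoToTransformation (𝒢 : DiscreteBorelGroupoid X) (μ : Measure X) : Prop :=
  ∃ (Γ : Type u) (_ : Group Γ) (_ : Countable Γ) (_ : MeasurableSpace Γ)
    (_ : DiscreteMeasurableSpace Γ) (Y : Type u) (_ : MeasurableSpace Y)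
    (_ : StandardBorelSpace Y) (ν : Measure Y) (_ : IsProbabilityMeasure ν)
    (_ : MulAction Γ Y) (_ : MeasurableConstSMul Γ Y),
    (∀ γ : Γ, Measure.QuasiMeasurePreserving (fun y : Y => γ • y) ν ν) ∧
      Isomorphic 𝒢 μ (transformation Γ Y) ν

/-- The isotropy `{g | s g = t g}`. -/
def isotropy (𝒢 : DiscreteBorelGroupoid X) : Set 𝒢.Arrow :=
  {g | 𝒢.s g = 𝒢.t g}

/-- The conjugacy class `Ω_E = ⋃ g, g E g⁻¹` of a set of arrows. -/
def conjClass (𝒢 : DiscreteBorelGroupoid X) (E : Set 𝒢.Arrow) : Set 𝒢.Arrow :=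
  {k | ∃ h ∈ E, ∃ g, ∃ (h₁ : 𝒢.s g = 𝒢.t h) (h₂ : 𝒢.s (𝒢.mul g h h₁) = 𝒢.t (𝒢.inv g)),
    k = 𝒢.mul (𝒢.mul g h h₁) (𝒢.inv g) h₂}

/-- The icc property: a non-null Borel set of isotropy arrows whose conjugacy class has finite
measure consists, up to a null set, of units. (On isotropy arrows `μ_s = μ_t`.) -/
def IsICC (𝒢 : DiscreteBorelGroupoid X) (μ : Measure X) : Prop :=
  ∀ E : Set 𝒢.Arrow, MeasurableSet E → E ⊆ 𝒢.isotropy → 𝒢.sMeas μ E ≠ 0 →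
    𝒢.sMeas μ (𝒢.conjClass E) < ∞ → 𝒢.sMeas μ (E \ Set.range 𝒢.one) = 0

/-- An ergodic groupoid is genuine if it is isomorphic neither to an equivalence relation nor to
a transformation groupoid. -/
def IsErgodicGenuine (𝒢 : DiscreteBorelGroupoid X) (μ : Measure X) : Prop :=
  IsErgodicRel 𝒢.orbitRel μ ∧ ¬ 𝒢.IsIsoToRel μ ∧ ¬ 𝒢.IsIsoToTransformation μ

end DiscreteBorelGroupoid

/-- A discrete measured groupoid with unit space `(X, μ)`: a discrete Borel groupoid for which
`μ_s` and `μ_t` have the same null sets. -/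
structure DiscreteMeasuredGroupoid (X : Type u) [MeasurableSpace X] (μ : Measure X) extends
    DiscreteBorelGroupoid X where
  quasiInvariant : ∀ A, MeasurableSet A →
    (toDiscreteBorelGroupoid.sMeas μ A = 0 ↔ toDiscreteBorelGroupoid.tMeas μ A = 0)

/-- The complete equivalence relation on a countable discrete space is countable Borel. -/
theorem isCountableBorelRel_top (S : Type u) [Countable S] [MeasurableSpace S]
    [DiscreteMeasurableSpace S] : IsCountableBorelRel (⊤ : Setoid S) where
  measurableSet_graph := MeasurableSet.of_discrete
  countable_class _ := Set.to_countable _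

/-- An ergodic countable measured equivalence relation is of type I if it is isomorphic to the
complete equivalence relation on a non-empty, finite or countably infinite set `S` (equipped with
the counting measure). -/
def IsErgodicTypeI {X : Type u} [MeasurableSpace X] [StandardBorelSpace X] (R : Setoid X)
    (hR : IsCountableBorelRel R) (μ : Measure X) : Prop :=
  ∃ (S : Type u) (_ : Nonempty S) (_ : Countable S) (_ : MeasurableSpace S)
    (_ : DiscreteMeasurableSpace S),
    DiscreteBorelGroupoid.Isomorphic (DiscreteBorelGroupoid.ofRel R hR) μ
      (DiscreteBorelGroupoid.ofRel (⊤ : Setoid S) (isCountableBorelRel_top S)) Measure.count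

/-! Suppose first that `μ` is diffuse. A Borel injection of `X` into the Cantor space attaches to
each point `x` a set of integers `S x` that determines `x`. The free group on two generators acts on
a countable set in a way that remembers `S x`: one generator shifts a strip `ℤ × Bool`, and the
other flips exactly the columns in `S x`. A free orbit is added to that set so that nontrivial group
elements move many points. Putting these actions side by side over `X` gives the standard Borel
group `Lamp S`, a generalised wreath product of `ZMod 2` by the free group. The elements whose lamps
lie over the class of `x` form a countable subgroup `lampSubgroup S R x`, which depends only on that
class. Adding this field of subgroups to `R` as isotropy gives the groupoid `ofSubgroups`, with
orbit relation `R`.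

This groupoid is not a relation, because its isotropy is nontrivial. An isomorphism with a
transformation groupoid of `Γ` would embed almost every isotropy group into the single countable
group `Γ` (`exists_injective_hom_of_isIsoToTransformation`). Such an embedding determines `S x`, and
so `x`, through the images of three elements, so only countably many `x` could occur
(`countable_of_forall_exists_injective`). A countable set cannot be conull for a diffuse measure.
The groupoid is icc because nontrivial conjugacy classes in the isotropy groups are infinite
(`infinite_conj_lampSubgroup`).

Conversely, if `μ` has an atom, ergodicity makes its class a conull countable set of atoms
(`IsErgodicRel.class_of_atom`). Then `R` is of type I. Every groupoid over `R` is, on that set,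
transitive, and is determined by one isotropy group and the set of units; giving the units a group
structure turns it into a transformation groupoid (`isIsoToTransformation_of_transitive`), so it is
not genuine. Type I in turn forces an atom, since counting measure has no null points. -/

/-! ### Null analytic sets and null sets of arrows -/

theorem isCompact_setOf_forall_le (n : ℕ → ℕ) : IsCompact {x : ℕ → ℕ | ∀ k, x k ≤ n k} := by
  convert isCompact_univ_pi (fun k => (Set.finite_Iic (n k)).isCompact) using 1
  ext x
  simp [Pi.le_def]

open Set Filter Topology in
/-- If `K` is the compact set `{x | ∀ k, x k ≤ n k}` of the Baire space, every open set containing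
`K` contains `{x | ∀ k < m, x k ≤ n k}` for some `m`. -/
theorem exists_forall_lt_le_subset_of_isOpen (n : ℕ → ℕ) {U : Set (ℕ → ℕ)} (hU : IsOpen U)
    (h : {x : ℕ → ℕ | ∀ k, x k ≤ n k} ⊆ U) :
    ∃ m, {x : ℕ → ℕ | ∀ k < m, x k ≤ n k} ⊆ U := by
  have hK := isCompact_setOf_forall_le n
  have hc : ∀ x ∈ {x : ℕ → ℕ | ∀ k, x k ≤ n k}, ∃ m, PiNat.cylinder x m ⊆ U := by
    intro x hx
    obtain ⟨v, hv, hxv, hvU⟩ := (PiNat.isTopologicalBasis_cylinders (fun _ => ℕ)).exists_subset_of_mem_open (h hx) hU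
    obtain ⟨y, m, rfl⟩ := hv
    refine ⟨m, ?_⟩
    rwa [PiNat.mem_cylinder_iff_eq.1 hxv]
  choose! m hm using hc
  obtain ⟨T, hT, hTK⟩ := hK.elim_nhds_subcover (fun x => PiNat.cylinder x (m x))
    (fun x _ => (PiNat.isOpen_cylinder _ x (m x)).mem_nhds (PiNat.self_mem_cylinder x (m x)))
  refine ⟨T.sup m, fun x hx => ?_⟩
  -- Keep the coordinates of `x` up to the longest cylinder of the finite cover and replace the tail
  -- by the bounds `n`. The resulting point lies in the compact set, and the cylinder that covers it
  -- also contains `x`.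
  have hx' : (fun k => if k < T.sup m then x k else n k) ∈ {x : ℕ → ℕ | ∀ k, x k ≤ n k} := by
    intro k
    by_cases hk : k < T.sup m
    · simpa [hk] using hx k hk
    · simp [hk]
  obtain ⟨y, hy, hxy⟩ := mem_iUnion₂.1 (hTK hx')
  refine hm y (hT y hy) fun k hk => ?_
  simpa only [if_pos (hk.trans_le (Finset.le_sup hy))] using hxy k hk

open Set Filter Topology in
/-- An analytic set all of whose measurable subsets are null is null. -/
theorem MeasureTheory.AnalyticSet.measure_eq_zero {X : Type*} [TopologicalSpace X] [PolishSpace X]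
    [MeasurableSpace X] [BorelSpace X] {μ : Measure X} [IsFiniteMeasure μ] {s : Set X}
    (hs : AnalyticSet s) (h : ∀ E ⊆ s, MeasurableSet E → μ E = 0) : μ s = 0 := by
  rw [AnalyticSet] at hs
  rcases hs with rfl | ⟨g, hg, rfl⟩
  · simp
  by_contra hne
  obtain ⟨c, hc0, hc⟩ := exists_between (pos_iff_ne_zero.2 hne)
  -- Bounding one more coordinate by a large enough number keeps the measure of the image above `c`.
  -- Continuity along increasing unions holds for arbitrary sets, so measurability of these images
  -- is not needed.
  have step : ∀ (S : {S : Set (ℕ → ℕ) // c < μ (g '' S)}) (k : ℕ),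
      ∃ n : ℕ, c < μ (g '' (S.1 ∩ {x | x k ≤ n})) := by
    intro S k
    have hmono : Monotone fun n : ℕ => g '' (S.1 ∩ {x | x k ≤ n}) := fun a b hab =>
      image_mono (inter_subset_inter_right _ fun x (hx : x k ≤ a) => hx.trans hab)
    have hU : ⋃ n : ℕ, g '' (S.1 ∩ {x | x k ≤ n}) = g '' S.1 := by
      rw [← image_iUnion, ← inter_iUnion]
      congr 1
      exact inter_eq_left.2 fun x _ => mem_iUnion.2 ⟨x k, le_refl (x k)⟩
    have := hmono.measure_iUnion (μ := μ)
    rw [hU] at this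
    have h2 := S.2
    rw [this] at h2
    exact lt_iSup_iff.1 h2
  choose ν hν using step
  let S : ℕ → {S : Set (ℕ → ℕ) // c < μ (g '' S)} := fun k =>
    Nat.rec ⟨univ, by rwa [image_univ]⟩ (fun k S => ⟨S.1 ∩ {x | x k ≤ ν S k}, hν S k⟩) k
  let n : ℕ → ℕ := fun k => ν (S k) k
  have hS : ∀ k, (S k).1 = {x | ∀ j < k, x j ≤ n j} := by
    intro k
    induction k with
    | zero => simp [S]
    | succ k ih =>
      have : (S (k + 1)).1 = (S k).1 ∩ {x | x k ≤ n k} := rfl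
      rw [this, ih]
      ext x
      simp only [mem_inter_iff, mem_ofPred_eq, Nat.lt_succ_iff_lt_or_eq]
      constructor
      · rintro ⟨h1, h2⟩ j (hj | rfl)
        exacts [h1 j hj, h2]
      · exact fun h => ⟨fun j hj => h j (Or.inl hj), h k (Or.inr rfl)⟩
  have hK := isCompact_setOf_forall_le n
  have hzero := h (g '' {x | ∀ k, x k ≤ n k}) (image_subset_range _ _)
    (hK.image hg).isClosed.measurableSet
  have hlt : μ (g '' {x | ∀ k, x k ≤ n k}) < c := hzero ▸ hc0
  -- The image of the compact set is null, so an open set around it has measure below `c`. By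
  -- compactness that open set already contains the image of some finite stage `S m`, whose measure
  -- exceeds `c`.
  obtain ⟨O, hO, hOo, hOc⟩ := (g '' {x | ∀ k, x k ≤ n k}).exists_isOpen_lt_of_lt c hlt
  obtain ⟨m, hm⟩ := exists_forall_lt_le_subset_of_isOpen n (hOo.preimage hg) (image_subset_iff.1 hO)
  have h1 := (S m).2
  rw [hS] at h1
  exact absurd (h1.trans_le (measure_mono (image_subset_iff.2 hm))) hOc.not_gt

/-- A Borel image all of whose measurable subsets are null is null. -/
theorem MeasurableSet.measure_image_eq_zero {X Y : Type*} [MeasurableSpace X] [StandardBorelSpace X]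
    [MeasurableSpace Y] [StandardBorelSpace Y] {μ : Measure X} [IsFiniteMeasure μ] {f : Y → X}
    {A : Set Y} (hA : MeasurableSet A) (hf : Measurable f)
    (h : ∀ E ⊆ f '' A, MeasurableSet E → μ E = 0) : μ (f '' A) = 0 := by
  let := upgradeStandardBorel X
  exact (hA.analyticSet_image hf).measure_eq_zero h

/-- The integral of the number of points of `A` in the fibres of `f` vanishes exactly when `f '' A`
is null. -/
theorem lintegral_encard_fiber_eq_zero_iff {X Y : Type*} [MeasurableSpace X] [StandardBorelSpace X]
    [MeasurableSpace Y] [StandardBorelSpace Y] {μ : Measure X} [IsFiniteMeasure μ] {f : Y → X}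
    (hf : Measurable f) {A : Set Y} (hA : MeasurableSet A) :
    ∫⁻ x, ({g ∈ A | f g = x}.encard : ℝ≥0∞) ∂μ = 0 ↔ μ (f '' A) = 0 := by
  constructor
  · intro h
    refine hA.measure_image_eq_zero hf fun E hE hEm => le_antisymm ?_ zero_le
    rw [← h, ← lintegral_indicator_one hEm]
    refine lintegral_mono fun x => ?_
    by_cases hx : x ∈ E
    · obtain ⟨g, hg, rfl⟩ := hE hx
      have : (1 : ℕ∞) ≤ {k ∈ A | f k = f g}.encard :=
        Set.one_le_encard_iff_nonempty.2 ⟨g, hg, rfl⟩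
      simpa [hx] using (ENat.toENNReal_le (m := 1)).2 this
    · simp [hx]
  · intro h
    refine lintegral_eq_zero_of_ae_eq_zero ?_
    filter_upwards [measure_eq_zero_iff_ae_notMem.1 h] with x hx
    have : {g ∈ A | f g = x} = ∅ := by
      ext g
      simp only [Set.mem_ofPred_eq, Set.mem_empty_iff_false, iff_false, not_and]
      rintro hg rfl
      exact hx ⟨g, hg, rfl⟩
    simp [this]

/-! ### Groupoids with a prescribed field of isotropy groups -/

namespace DiscreteBorelGroupoid

variable {X : Type u} [MeasurableSpace X]

/-- A groupoid whose orbit relation is nonsingular is itself nonsingular. -/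
theorem sMeas_eq_zero_iff_tMeas_eq_zero [StandardBorelSpace X] (𝒢 : DiscreteBorelGroupoid X)
    {μ : Measure X} [IsFiniteMeasure μ] (h𝒢 : IsCountableMeasuredRel 𝒢.orbitRel μ)
    {A : Set 𝒢.Arrow} (hA : MeasurableSet A) : 𝒢.sMeas μ A = 0 ↔ 𝒢.tMeas μ A = 0 := by
  rw [sMeas, tMeas, lintegral_encard_fiber_eq_zero_iff 𝒢.measurable_s hA,
    lintegral_encard_fiber_eq_zero_iff 𝒢.measurable_t hA]
  have key : ∀ S T : Set X, μ S = 0 → T ⊆ relSaturation 𝒢.orbitRel S → μ T = 0 := by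
    intro S T hS hT
    -- `S` need not be Borel, so nonsingularity is applied to a measurable hull.
    refine measure_mono_null ?_ (h𝒢.saturation_null (toMeasurable μ S)
      (measurableSet_toMeasurable μ S) (by rwa [measure_toMeasurable]))
    intro y hy
    obtain ⟨x, hx, hxy⟩ := hT hy
    exact ⟨x, subset_toMeasurable μ S hx, hxy⟩
  constructor
  · refine fun h => key _ _ h ?_
    rintro _ ⟨g, hg, rfl⟩
    exact ⟨𝒢.s g, ⟨g, hg, rfl⟩, g, rfl, rfl⟩
  · refine fun h => key _ _ h ?_
    rintro _ ⟨g, hg, rfl⟩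
    exact ⟨𝒢.t g, ⟨g, hg, rfl⟩, 𝒢.inv g, 𝒢.t_inv g, 𝒢.s_inv g⟩

/-- The groupoid of a Borel field of countable subgroups of a standard Borel group `H` that is
constant along the classes of a countable Borel equivalence relation: the arrows are the triples
`(x, y, h)` with `x ∼ y` and `h ∈ D x = D y`, with target `x` and source `y`, and
`(x, y, g) (y, z, h) = (x, z, g * h)`. -/
def ofSubgroups [StandardBorelSpace X] {R : Setoid X} (hR : IsCountableBorelRel R)
    {H : Type u} [Group H] [MeasurableSpace H] [StandardBorelSpace H] [MeasurableMul₂ H]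
    [MeasurableInv H] (D : X → Subgroup H) (hD : MeasurableSet {p : X × H | p.2 ∈ D p.1})
    (hDR : ∀ x y, R x y → D x = D y) (hDc : ∀ x, (D x : Set H).Countable) :
    DiscreteBorelGroupoid X where
  Arrow := {p : (X × X) × H // R p.1.1 p.1.2 ∧ p.2 ∈ D p.1.1}
  standardBorelSpace := by
    refine MeasurableSet.standardBorel (MeasurableSet.inter (s₁ := {p : (X × X) × H | R p.1.1 p.1.2})
      (hR.measurableSet_graph.preimage measurable_fst)
      (hD.preimage (f := fun p : (X × X) × H => (p.1.1, p.2)) (by fun_prop)))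
  s p := p.1.1.2
  t p := p.1.1.1
  one x := ⟨((x, x), 1), R.refl x, (D x).one_mem⟩
  inv p := ⟨((p.1.1.2, p.1.1.1), p.1.2⁻¹), R.symm p.2.1,
    hDR _ _ p.2.1 ▸ (D p.1.1.1).inv_mem p.2.2⟩
  mul p q hpq := ⟨((p.1.1.1, q.1.1.2), p.1.2 * q.1.2), R.trans p.2.1 (by rw [hpq]; exact q.2.1),
    (D p.1.1.1).mul_mem p.2.2 (by rw [hDR _ _ p.2.1, hpq]; exact q.2.2)⟩
  s_one _ := rfl
  t_one _ := rfl
  s_inv _ := rfl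
  t_inv _ := rfl
  s_mul _ _ _ := rfl
  t_mul _ _ _ := rfl
  mul_assoc _ _ _ _ _ := Subtype.ext (Prod.ext rfl (_root_.mul_assoc _ _ _))
  one_mul _ := Subtype.ext (Prod.ext rfl (_root_.one_mul _))
  mul_one _ := Subtype.ext (Prod.ext rfl (_root_.mul_one _))
  inv_mul _ := Subtype.ext (Prod.ext rfl (inv_mul_cancel _))
  mul_inv _ := Subtype.ext (Prod.ext rfl (mul_inv_cancel _))
  measurable_s := by fun_prop
  measurable_t := by fun_prop
  measurable_one := Measurable.subtype_mk (by fun_prop)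
  measurable_inv := Measurable.subtype_mk (by fun_prop)
  measurable_mul := Measurable.subtype_mk (by fun_prop)
  countable_s x := by
    refine Set.MapsTo.countable_of_injOn (f := fun p => (p.1.1.1, p.1.2))
      (t := {y | R y x} ×ˢ (D x : Set H)) ?_ ?_ ((hR.countable_class x).prod (hDc x))
    · rintro ⟨⟨⟨a, b⟩, h⟩, hab, hh⟩ (rfl : b = x)
      exact ⟨hab, hDR _ _ hab ▸ hh⟩
    · rintro ⟨⟨⟨a, b⟩, h⟩, hab, hh⟩ (rfl : b = x) ⟨⟨⟨a', b'⟩, h'⟩, hab', hh'⟩ (rfl : b' = b) he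
      obtain ⟨rfl, rfl⟩ := Prod.mk.inj he
      rfl
  countable_t x := by
    refine Set.MapsTo.countable_of_injOn (f := fun p => (p.1.1.2, p.1.2))
      (t := {y | R y x} ×ˢ (D x : Set H)) ?_ ?_ ((hR.countable_class x).prod (hDc x))
    · rintro ⟨⟨⟨a, b⟩, h⟩, hab, hh⟩ (rfl : a = x)
      exact ⟨R.symm hab, hh⟩
    · rintro ⟨⟨⟨a, b⟩, h⟩, hab, hh⟩ (rfl : a = x) ⟨⟨⟨a', b'⟩, h'⟩, hab', hh'⟩ (rfl : a' = a) he
      obtain ⟨rfl, rfl⟩ := Prod.mk.inj he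
      rfl

section ofSubgroups

variable [StandardBorelSpace X] {R : Setoid X} (hR : IsCountableBorelRel R)
  {H : Type u} [Group H] [MeasurableSpace H] [StandardBorelSpace H] [MeasurableMul₂ H]
  [MeasurableInv H] {D : X → Subgroup H} (hD : MeasurableSet {p : X × H | p.2 ∈ D p.1})
  (hDR : ∀ x y, R x y → D x = D y) (hDc : ∀ x, (D x : Set H).Countable)

theorem orbitRel_ofSubgroups : (ofSubgroups hR D hD hDR hDc).orbitRel = R := by
  ext x y
  constructor
  · rintro ⟨g, rfl, rfl⟩
    exact g.2.1
  · exact fun h => ⟨⟨((x, y), 1), h, (D x).one_mem⟩, rfl, rfl⟩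

/-- The isotropy arrow at `x` given by an element of `D x`. -/
def ofSubgroups.loop (x : X) (h : D x) : (ofSubgroups hR D hD hDR hDc).Arrow :=
  ⟨((x, x), h), R.refl x, h.2⟩

/-- If all conjugacy classes of nontrivial elements of the groups `D x` are infinite, the groupoid
of the field `D` is icc. -/
theorem isICC_ofSubgroups (μ : Measure X)
    (hicc : ∀ x, ∀ h : D x, h ≠ 1 → (Set.range fun g : D x => g * h * g⁻¹).Infinite) :
    (ofSubgroups hR D hD hDR hDc).IsICC μ := by
  intro E _ hEi _ hfin
  by_contra hne
  -- No measurability of the fibre count is needed: a nonzero lower integral gives a simple function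
  -- below the count, whose support is measurable and non-null. Over that support every fibre of the
  -- conjugacy class will be infinite.
  obtain ⟨φ, hφ, hφ0⟩ : ∃ φ : SimpleFunc X ℝ≥0∞,
      (∀ x, φ x ≤ ({g ∈ E \ Set.range (ofSubgroups hR D hD hDR hDc).one |
        (ofSubgroups hR D hD hDR hDc).s g = x}.encard : ℝ≥0∞)) ∧ φ.lintegral μ ≠ 0 := by
    by_contra! hcon
    refine hne ?_
    rw [sMeas, lintegral]
    simp only [ENNReal.iSup_eq_zero]
    exact fun φ hφ => hcon φ hφ
  have hW : μ (Function.support φ) ≠ 0 := fun h => hφ0 (by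
    rw [← SimpleFunc.lintegral_eq_lintegral]
    exact lintegral_eq_zero_of_ae_eq_zero (measure_eq_zero_iff_ae_notMem.1 h |>.mono fun x hx =>
      Function.notMem_support.1 hx))
  refine hfin.ne (top_unique ?_)
  calc (∞ : ℝ≥0∞) = ∞ * μ (Function.support φ) := (ENNReal.top_mul hW).symm
    _ = ∫⁻ x, (Function.support φ).indicator (fun _ => ∞) x ∂μ :=
        (lintegral_indicator_const φ.measurableSet_support ∞).symm
    _ ≤ _ := lintegral_mono fun x => ?_
  by_cases hx : x ∈ Function.support φ
  swap
  · simp [hx]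
  have hpos := (pos_iff_ne_zero.2 hx).trans_le (hφ x)
  rw [← ENat.toENNReal_zero, ENat.toENNReal_lt, Set.encard_pos] at hpos
  obtain ⟨⟨⟨⟨a, b⟩, h⟩, hab, hh⟩, ⟨hgE, hg1⟩, (rfl : b = x)⟩ := hpos
  obtain rfl : b = a := hEi hgE
  have h1 : (⟨h, hh⟩ : D b) ≠ 1 := by
    intro h1
    refine hg1 ⟨b, Subtype.ext (Prod.ext rfl ?_)⟩
    exact (congrArg Subtype.val h1).symm
  -- Conjugating the arrow by loops at `b` stays in the fibre over `b`, so the infinite conjugacy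
  -- class in `D b` embeds into it.
  have hinf : {k ∈ (ofSubgroups hR D hD hDR hDc).conjClass E |
      (ofSubgroups hR D hD hDR hDc).s k = b}.Infinite := by
    refine Set.Infinite.mono ?_ ((hicc b ⟨h, hh⟩ h1).image
      (f := ofSubgroups.loop hR hD hDR hDc b) ?_)
    · rintro _ ⟨_, ⟨g, rfl⟩, rfl⟩
      exact ⟨⟨_, hgE, ofSubgroups.loop hR hD hDR hDc b g, rfl, rfl, rfl⟩, rfl⟩
    · intro g _ g' _ hgg'
      exact Subtype.ext (congrArg (fun p => p.1.2) hgg')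
  simp [hinf.encard_eq]

/-- Restriction to a set of units keeps the whole isotropy group at each remaining point. An
isomorphism of measured groupoids can therefore be tested against the group `D x` at any single
point of its domain. -/
theorem exists_restrict_loop_injective {A : Set X} (hA : MeasurableSet A) (x : A) :
    ∃ l : D x → ((ofSubgroups hR D hD hDR hDc).restrict A hA).Arrow, Function.Injective l ∧
      ∀ g h, ∃ hgh : ((ofSubgroups hR D hD hDR hDc).restrict A hA).s (l g) =
        ((ofSubgroups hR D hD hDR hDc).restrict A hA).t (l h),
      ((ofSubgroups hR D hD hDR hDc).restrict A hA).mul (l g) (l h) hgh = l (g * h) := by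
  refine ⟨fun h => ⟨ofSubgroups.loop hR hD hDR hDc x h, x.2, x.2⟩, ?_, fun g h => ⟨rfl, rfl⟩⟩
  intro g g' hgg'
  exact Subtype.ext (congrArg (fun p => p.1.1.2) hgg')

/-- The groupoid of a field of nontrivial groups is not isomorphic to an equivalence relation. -/
theorem not_isIsoToRel_ofSubgroups (μ : Measure X) [NeZero μ]
    (hD1 : ∀ x, ∃ h : D x, h ≠ 1) : ¬ (ofSubgroups hR D hD hDR hDc).IsIsoToRel μ := by
  rintro ⟨Y, _, _, ν, _, S, hS, A, hA, B, hB, hμA, -, φ, -⟩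
  obtain ⟨x, hx⟩ : A.Nonempty := by
    rw [Set.nonempty_iff_ne_empty]
    rintro rfl
    simp [NeZero.ne μ] at hμA
  obtain ⟨l, hl, hmul⟩ := exists_restrict_loop_injective hR hD hDR hDc hA ⟨x, hx⟩
  obtain ⟨h, hh⟩ := hD1 x
  refine hh (hl (φ.toEquiv.injective ?_))
  -- In a relation an arrow is determined by its endpoints. Loops are composable with themselves and
  -- with each other, so they are all sent to the same diagonal pair.
  have hs : ∀ g, (φ.toEquiv (l g)).1.1.1 = (φ.toEquiv (l g)).1.1.2 := fun g =>
    (congrArg Subtype.val ((φ.composable_iff _ _).1 (hmul g g).1)).symm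
  have hst : (φ.toEquiv (l h)).1.1.2 = (φ.toEquiv (l 1)).1.1.1 :=
    congrArg Subtype.val ((φ.composable_iff _ _).1 (hmul h 1).1)
  refine Subtype.ext (Subtype.ext (Prod.ext ?_ ?_))
  · exact (hs h).trans hst
  · exact hst.trans (hs 1)

/-- If the groupoid of a field of subgroups is isomorphic to the transformation groupoid of an
action of `Γ`, almost all groups of the field embed into `Γ`. -/
theorem exists_injective_hom_of_isIsoToTransformation (μ : Measure X)
    (h : (ofSubgroups hR D hD hDR hDc).IsIsoToTransformation μ) :
    ∃ (Γ : Type u) (_ : Group Γ) (_ : Countable Γ) (A : Set X), μ Aᶜ = 0 ∧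
      ∀ x ∈ A, ∃ ψ : D x →* Γ, Function.Injective ψ := by
  obtain ⟨Γ, _, hΓ, _, _, Y, _, _, ν, _, _, _, -, A, hA, B, hB, hμA, -, φ, -⟩ := h
  refine ⟨Γ, inferInstance, hΓ, A, hμA, fun x hx => ?_⟩
  obtain ⟨l, hl, hmul⟩ := exists_restrict_loop_injective hR hD hDR hDc hA ⟨x, hx⟩
  -- The group coordinate of a transformation groupoid is multiplicative. It is injective on loops
  -- at `x`, because composability sends them all to arrows with one common source.
  refine ⟨MonoidHom.mk' (fun h => (φ.toEquiv (l h)).1.2) fun g h => ?_, fun g h hgh => ?_⟩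
  · rw [← (hmul g h).2, φ.map_mul]
    rfl
  · have hgs : (φ.toEquiv (l g)).1.1 = (φ.toEquiv (l h)).1.2 • (φ.toEquiv (l h)).1.1 :=
      congrArg Subtype.val ((φ.composable_iff _ _).1 (hmul g h).1)
    have hhs : (φ.toEquiv (l h)).1.1 = (φ.toEquiv (l h)).1.2 • (φ.toEquiv (l h)).1.1 :=
      congrArg Subtype.val ((φ.composable_iff _ _).1 (hmul h h).1)
    exact hl (φ.toEquiv.injective (Subtype.ext (Prod.ext (hgs.trans hhs.symm) hgh)))

end ofSubgroups

end DiscreteBorelGroupoid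

/-! ### Finitely supported functions as a standard Borel group -/

/-- A measurable space that embeds measurably into a standard Borel space is standard Borel. -/
theorem MeasurableEmbedding.standardBorelSpace {α β : Type*} [MeasurableSpace α]
    [MeasurableSpace β] [StandardBorelSpace β] {f : α → β} (hf : MeasurableEmbedding f) :
    StandardBorelSpace α := by
  have : StandardBorelSpace (Set.range f) := hf.measurableSet_range.standardBorel
  let := upgradeStandardBorel (Set.range f)
  let e := hf.equivRange
  let : TopologicalSpace α := TopologicalSpace.induced e inferInstance
  refine ⟨inferInstance, ⟨?_⟩, e.toEquiv.polishSpace_induced⟩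
  rw [borel_comap, ← BorelSpace.measurable_eq]
  exact e.measurableEmbedding.comap_eq.symm

namespace Finsupp

variable {Z : Type*}

/-- The sum of the values of a finitely supported function on a set. -/
noncomputable def sumOn (V : Set Z) : (Z →₀ ZMod 2) →ₗ[ZMod 2] ZMod 2 :=
  linearCombination (ZMod 2) (V.indicator 1)

theorem sumOn_single (V : Set Z) (z : Z) (c : ZMod 2) :
    sumOn V (single z c) = c * V.indicator 1 z := by
  simp [sumOn, linearCombination_single]

theorem sumOn_equivMapDomain (V : Set Z) (σ : Z ≃ Z) (f : Z →₀ ZMod 2) :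
    sumOn V (equivMapDomain σ f) = sumOn (σ ⁻¹' V) f := by
  rw [sumOn, linearCombination_equivMapDomain]
  rfl

variable [MeasurableSpace Z]

/-- The `σ`-algebra generated by the sums on measurable sets. -/
noncomputable instance measurableSpaceZModTwo : MeasurableSpace (Z →₀ ZMod 2) :=
  ⨆ V : {V : Set Z // MeasurableSet V}, MeasurableSpace.comap (sumOn V.1) ⊤

theorem measurable_sumOn {V : Set Z} (hV : MeasurableSet V) : Measurable (sumOn V) :=
  measurable_iff_comap_le.2 (le_iSup
    (fun V : {V : Set Z // MeasurableSet V} => MeasurableSpace.comap (sumOn V.1) ⊤) ⟨V, hV⟩)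

theorem measurable_iff_sumOn {α : Type*} [MeasurableSpace α] {f : α → Z →₀ ZMod 2} :
    Measurable f ↔ ∀ V, MeasurableSet V → Measurable fun a => sumOn V (f a) := by
  refine ⟨fun h V hV => (measurable_sumOn hV).comp h, fun h => ?_⟩
  rw [measurable_iff_comap_le, measurableSpaceZModTwo, MeasurableSpace.comap_iSup]
  refine iSup_le fun V => ?_
  rw [MeasurableSpace.comap_comp]
  exact (h V.1 V.2).comap_le

instance : MeasurableAdd₂ (Z →₀ ZMod 2) where
  measurable_add := measurable_iff_sumOn.2 fun V hV => by
    simp only [map_add]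
    exact (measurable_of_countable (fun p : ZMod 2 × ZMod 2 => p.1 + p.2)).comp
      (((measurable_sumOn hV).comp measurable_fst).prodMk
        ((measurable_sumOn hV).comp measurable_snd))

instance : MeasurableNeg (Z →₀ ZMod 2) where
  measurable_neg := measurable_iff_sumOn.2 fun V hV => by
    simp only [map_neg]
    exact (measurable_of_countable (fun p : ZMod 2 => -p)).comp (measurable_sumOn hV)

theorem measurable_equivMapDomain {σ : Z ≃ Z} (hσ : Measurable σ) :
    Measurable (equivMapDomain (M := ZMod 2) σ) :=
  measurable_iff_sumOn.2 fun V hV => by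
    simp only [sumOn_equivMapDomain]
    exact measurable_sumOn (hσ hV)

theorem measurable_single_one : Measurable fun z : Z => single z (1 : ZMod 2) :=
  measurable_iff_sumOn.2 fun V hV => by
    simp only [sumOn_single, one_mul]
    exact measurable_one.indicator hV

variable [StandardBorelSpace Z]

/-- After embedding `Z` in the reals, a rational interval separates any point of the finite support
from the others. The sum over that interval is the nonzero value at the point. -/
theorem eq_zero_of_forall_sumOn_Ioo {f : Z →₀ ZMod 2}
    (h : ∀ a b : ℚ, sumOn (embeddingReal Z ⁻¹' Set.Ioo (a : ℝ) b) f = 0) : f = 0 := by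
  classical
  by_contra hf
  obtain ⟨z, hz⟩ := Finsupp.support_nonempty_iff.2 hf
  have hinj := (measurableEmbedding_embeddingReal Z).injective
  have hfin : ((embeddingReal Z) '' (f.support.erase z : Set Z)).Finite :=
    (Finset.finite_toSet _).image _
  have hmem : embeddingReal Z z ∈ ((embeddingReal Z) '' (f.support.erase z : Set Z))ᶜ := by
    rintro ⟨w, hw, hwz⟩
    rw [hinj hwz] at hw
    simp at hw
  obtain ⟨V, hV, hzV, hVsub⟩ := Real.isTopologicalBasis_Ioo_rat.exists_subset_of_mem_open hmem
    hfin.isClosed.isOpen_compl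
  simp only [Set.mem_iUnion, Set.mem_singleton_iff] at hV
  obtain ⟨a, b, -, rfl⟩ := hV
  have h0 := h a b
  rw [sumOn, linearCombination_apply, Finsupp.sum, Finset.sum_eq_single z] at h0
  · rw [Set.indicator_of_mem (s := embeddingReal Z ⁻¹' Set.Ioo (a : ℝ) b) hzV] at h0
    exact Finsupp.mem_support_iff.1 hz (by simpa using h0)
  · intro w hw hwz
    rw [Set.indicator_of_notMem, smul_zero]
    exact fun hwV => hVsub hwV ⟨w, by simpa [hwz] using hw, rfl⟩
  · exact fun hz' => absurd hz hz'

/-- Countable separation is what lets the Lusin–Souslin theorem apply to Borel injections into this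
space. -/
instance : MeasurableSpace.CountablySeparated (Z →₀ ZMod 2) := by
  refine ⟨⟨Set.range fun q : (ℚ × ℚ) × ZMod 2 =>
    sumOn (embeddingReal Z ⁻¹' Set.Ioo (q.1.1 : ℝ) q.1.2) ⁻¹' {q.2}, Set.countable_range _, ?_, ?_⟩⟩
  · rintro _ ⟨q, rfl⟩
    exact measurable_sumOn (measurable_embeddingReal Z measurableSet_Ioo) (measurableSet_singleton _)
  · intro f _ g _ h
    rw [← sub_eq_zero]
    refine eq_zero_of_forall_sumOn_Ioo fun a b => ?_
    have := (h _ ⟨((a, b), sumOn (embeddingReal Z ⁻¹' Set.Ioo (a : ℝ) b) g), rfl⟩).2 rfl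
    rw [map_sub, sub_eq_zero]
    exact this

/-- A Borel encoding of the finitely supported functions by finite sequences. -/
theorem exists_measurableEmbedding_seq (Z : Type*) [MeasurableSpace Z] [StandardBorelSpace Z]
    [Nonempty Z] : ∃ enc : (Z →₀ ZMod 2) → ℕ × (ℕ → Z), MeasurableEmbedding enc ∧
      ∀ f, (f.support : Set Z) = (enc f).2 '' Set.Iio (enc f).1 := by
  classical
  let z₀ : Z := Classical.arbitrary Z
  let e := embeddingReal Z
  have he : Measurable e := measurable_embeddingReal Z
  let : LinearOrder Z := LinearOrder.lift' e (measurableEmbedding_embeddingReal Z).injective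
  -- Requiring the first entries to increase and padding the tail with `z₀` makes the code of each
  -- finite set unique.
  let M : Set (ℕ × (ℕ → Z)) :=
    {p | (∀ i j, i < j → j < p.1 → e (p.2 i) < e (p.2 j)) ∧ ∀ i, p.1 ≤ i → p.2 i = z₀}
  have hM : MeasurableSet M := by
    refine measurableSet_setOfPred.2 (Measurable.and ?_ ?_)
    · refine Measurable.forall fun i => Measurable.forall fun j => Measurable.imp measurable_const
        (Measurable.imp ?_ ?_)
      · exact (measurable_of_countable (fun n : ℕ => j < n)).comp measurable_fst
      · exact measurableSet_setOfPred.1 (measurableSet_lt (by fun_prop) (by fun_prop))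
    · refine Measurable.forall fun i => Measurable.imp ?_ ?_
      · exact (measurable_of_countable (fun n : ℕ => n ≤ i)).comp measurable_fst
      · exact measurableSet_setOfPred.1
          ((measurableSet_singleton z₀).preimage (f := fun p : ℕ × (ℕ → Z) => p.2 i) (by fun_prop))
  have : StandardBorelSpace M := hM.standardBorel
  let q : ℕ × (ℕ → Z) → Z →₀ ZMod 2 := fun p => ∑ i ∈ Finset.range p.1, single (p.2 i) 1
  have hq : Measurable q := by
    have hq' : Measurable fun p : (ℕ → Z) × ℕ =>
        ∑ i ∈ Finset.range p.2, single (p.1 i) (1 : ZMod 2) := by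
      refine measurable_from_prod_countable_left fun n => ?_
      exact Finset.measurable_fun_sum (f := fun i (v : ℕ → Z) => single (v i) (1 : ZMod 2))
        (Finset.range n) fun i _ => measurable_single_one.comp (measurable_pi_apply i)
    exact hq'.comp measurable_swap
  have hinjM : ∀ p ∈ M, Set.InjOn p.2 (Finset.range p.1 : Set ℕ) := by
    intro p hp i hi j hj hij
    rcases lt_trichotomy i j with h | h | h
    · exact absurd (congrArg e hij) (hp.1 i j h (by simpa using hj)).ne
    · exact h
    · exact absurd (congrArg e hij) (hp.1 j i h (by simpa using hi)).ne'
  have hsupp : ∀ p ∈ M, (q p).support = (Finset.range p.1).image p.2 := by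
    intro p hp
    ext z
    have hz : q p z = ∑ i ∈ Finset.range p.1, if p.2 i = z then 1 else 0 := by
      simp only [q, Finsupp.finsetSum_apply, Finsupp.single_apply]
    rw [Finsupp.mem_support_iff, hz, Finset.mem_image]
    constructor
    · intro h
      obtain ⟨i, hi, hi'⟩ := Finset.exists_ne_zero_of_sum_ne_zero h
      exact ⟨i, hi, by by_contra hc; simp [hc] at hi'⟩
    · rintro ⟨i, hi, rfl⟩
      rw [Finset.sum_eq_single i]
      · simp
      · intro j hj hji
        rw [if_neg]
        exact fun h => hji (hinjM p hp (by exact_mod_cast hj) (by exact_mod_cast hi) h)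
      · exact fun h => absurd hi h
  have hcard : ∀ p ∈ M, (q p).support.card = p.1 := by
    intro p hp
    rw [hsupp p hp, Finset.card_image_of_injOn (hinjM p hp), Finset.card_range]
  have hqinj : Set.InjOn q M := by
    intro p hp p' hp' hpp'
    have hc := hcard p hp
    have hc' := hcard p' hp'
    obtain ⟨n, v⟩ := p
    obtain ⟨n', v'⟩ := p'
    obtain rfl : n = n' := hc.symm.trans ((congrArg (fun f => f.support.card) hpp').trans hc')
    have h1 := Finset.orderEmbOfFin_unique hc (f := fun i : Fin n => v i)
      (fun i => by rw [hsupp _ hp]; exact Finset.mem_image_of_mem _ (by simp))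
      (fun i j hij => hp.1 i j hij j.2)
    have h2 := Finset.orderEmbOfFin_unique hc (f := fun i : Fin n => v' i)
      (fun i => by rw [hpp', hsupp _ hp']; exact Finset.mem_image_of_mem _ (by simp))
      (fun i j hij => hp'.1 i j hij j.2)
    refine Prod.ext rfl (funext fun i => ?_)
    by_cases hi : i < n
    · exact congrFun (h1.trans h2.symm) ⟨i, hi⟩
    · exact (hp.2 i (not_lt.1 hi)).trans (hp'.2 i (not_lt.1 hi)).symm
  have hsurj : ∀ f, ∃ p ∈ M, q p = f := by
    intro f
    let v : ℕ → Z := fun i => if h : i < f.support.card then f.support.orderEmbOfFin rfl ⟨i, h⟩ else z₀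
    have hp : (f.support.card, v) ∈ M := by
      refine ⟨fun i j hij hj => ?_, fun i hi => dif_neg (not_lt.2 hi)⟩
      have hi : i < f.support.card := hij.trans hj
      simp only [v, hi, hj, dif_pos]
      exact (f.support.orderEmbOfFin rfl).strictMono (show (⟨i, hi⟩ : Fin _) < ⟨j, hj⟩ from hij)
    refine ⟨_, hp, ?_⟩
    have hs : (q (f.support.card, v)).support = f.support := by
      refine Finset.eq_of_subset_of_card_le ?_ (hcard _ hp).ge
      rw [hsupp _ hp]
      intro z hz
      obtain ⟨i, hi, rfl⟩ := Finset.mem_image.1 hz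
      have hi' : i < f.support.card := by simpa using hi
      simp only [v, hi', dif_pos]
      exact Finset.orderEmbOfFin_mem _ _ _
    have h01 : ∀ c : ZMod 2, c ≠ 0 → c = 1 := by decide
    ext z
    have hzs := Finset.ext_iff.1 hs z
    by_cases hz : z ∈ f.support
    · rw [h01 _ (Finsupp.mem_support_iff.1 hz), h01 _ (Finsupp.mem_support_iff.1 (hzs.2 hz))]
    · rw [Finsupp.notMem_support_iff.1 hz, Finsupp.notMem_support_iff.1 (mt hzs.1 hz)]
  choose enc henc hqenc using hsurj
  -- Decoding is a Borel injection from a standard Borel space, so by Lusin–Souslin its inverse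
  -- `enc` is Borel.
  have hemb : MeasurableEmbedding fun p : M => q p.1 :=
    (hq.comp measurable_subtype_coe).measurableEmbedding
      fun p p' h => Subtype.ext (hqinj p.2 p'.2 h)
  have hencM : ∀ f, ∃ p : M, q p.1 = f := fun f => ⟨⟨enc f, henc f⟩, hqenc f⟩
  have hmeas : Measurable enc := by
    intro s hs
    have : enc ⁻¹' s = (fun p : M => q p.1) '' (Subtype.val ⁻¹' s) := by
      ext f
      constructor
      · exact fun h => ⟨⟨enc f, henc f⟩, h, hqenc f⟩
      · rintro ⟨p, hp, rfl⟩
        have : enc (q p.1) = p.1 := hqinj (henc _) p.2 (hqenc _)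
        rwa [Set.mem_preimage, this]
    rw [this]
    exact hemb.measurableSet_image.2 (measurable_subtype_coe hs)
  refine ⟨enc, ⟨fun f g h => by rw [← hqenc f, ← hqenc g, h], hmeas, fun s hs => ?_⟩, fun f => ?_⟩
  · have : enc '' s = M ∩ q ⁻¹' s := by
      ext p
      constructor
      · rintro ⟨f, hf, rfl⟩
        exact ⟨henc f, by rwa [Set.mem_preimage, hqenc]⟩
      · rintro ⟨hp, hps⟩
        exact ⟨q p, hps, hqinj (henc _) hp (hqenc _)⟩
    rw [this]
    exact hM.inter (hq hs)
  · conv_lhs => rw [← hqenc f, hsupp _ (henc f)]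
    simp

instance [Nonempty Z] : StandardBorelSpace (Z →₀ ZMod 2) := by
  obtain ⟨enc, henc, -⟩ := exists_measurableEmbedding_seq Z
  exact henc.standardBorelSpace

/-- The encoding turns the quantifier over the support into one over countably many indices. -/
theorem measurableSet_forall_mem_support [Nonempty Z] {α : Type*} [MeasurableSpace α]
    {P : α × Z → Prop} (hP : MeasurableSet {p | P p}) :
    MeasurableSet {p : α × (Z →₀ ZMod 2) | ∀ z ∈ p.2.support, P (p.1, z)} := by
  obtain ⟨enc, henc, hsupp⟩ := exists_measurableEmbedding_seq Z
  have : {p : α × (Z →₀ ZMod 2) | ∀ z ∈ p.2.support, P (p.1, z)} =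
      {p | ∀ i, i < (enc p.2).1 → P (p.1, (enc p.2).2 i)} := by
    ext p
    have h : ∀ z, z ∈ p.2.support ↔ z ∈ (enc p.2).2 '' Set.Iio (enc p.2).1 := fun z => by
      rw [← hsupp, Finset.mem_coe]
    simp only [Set.mem_ofPred_eq, h, Set.forall_mem_image, Set.mem_Iio]
  rw [this]
  have hm := henc.measurable
  refine measurableSet_setOfPred.2 (Measurable.forall fun i => Measurable.imp ?_ ?_)
  · exact (measurable_of_countable (fun n : ℕ => i < n)).comp (by fun_prop)
  · exact (measurableSet_setOfPred.1 hP).comp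
      (f := fun p : α × (Z →₀ ZMod 2) => (p.1, (enc p.2).2 i)) (by fun_prop)

end Finsupp

/-! ### Borel structure on semidirect products -/

namespace SemidirectProduct

variable {N G : Type*} [Group N] [Group G] {φ : G →* MulAut N} [MeasurableSpace N]
  [MeasurableSpace G]

instance : MeasurableSpace (N ⋊[φ] G) :=
  MeasurableSpace.comap equivProd inferInstance

/-- A semidirect product is Borel isomorphic to the product. -/
def measurableEquivProd : N ⋊[φ] G ≃ᵐ N × G where
  toEquiv := equivProd
  measurable_toFun := comap_measurable _
  measurable_invFun := measurable_comap_iff.2 measurable_id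

theorem measurable_left : Measurable (left : N ⋊[φ] G → N) :=
  measurable_fst.comp (measurableEquivProd (φ := φ)).measurable

theorem measurable_right : Measurable (right : N ⋊[φ] G → G) :=
  measurable_snd.comp (measurableEquivProd (φ := φ)).measurable

instance [StandardBorelSpace N] [StandardBorelSpace G] : StandardBorelSpace (N ⋊[φ] G) :=
  (measurableEquivProd (φ := φ)).measurableEmbedding.standardBorelSpace

theorem measurable_of_left_right {α : Type*} [MeasurableSpace α] {f : α → N ⋊[φ] G}
    (h : Measurable fun a => (f a).left) (h' : Measurable fun a => (f a).right) : Measurable f :=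
  measurable_comap_iff.2 (h.prodMk h')

variable [Countable G] [DiscreteMeasurableSpace G]

theorem measurable_apply_of_countable (hφ : ∀ g, Measurable (φ g)) {α : Type*} [MeasurableSpace α]
    {f : α → N} {g : α → G} (hf : Measurable f) (hg : Measurable g) :
    Measurable fun a => φ (g a) (f a) := by
  have : Measurable fun p : N × G => φ p.2 p.1 := measurable_from_prod_countable_left hφ
  exact this.comp (hf.prodMk hg)

theorem measurableMul₂ [MeasurableMul₂ N] (hφ : ∀ g, Measurable (φ g)) :
    MeasurableMul₂ (N ⋊[φ] G) where
  measurable_mul := measurable_of_left_right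
    ((measurable_left.comp measurable_fst).mul (measurable_apply_of_countable hφ
      (measurable_left.comp measurable_snd) (measurable_right.comp measurable_fst)))
    ((measurable_of_countable (fun p : G × G => p.1 * p.2)).comp
      ((measurable_right.comp measurable_fst).prodMk (measurable_right.comp measurable_snd)))

theorem measurableInv [MeasurableInv N] (hφ : ∀ g, Measurable (φ g)) :
    MeasurableInv (N ⋊[φ] G) where
  measurable_inv := by
    have h : Measurable fun a : N ⋊[φ] G => a.right⁻¹ :=
      (measurable_of_countable (fun g : G => g⁻¹)).comp measurable_right
    exact measurable_of_left_right (measurable_apply_of_countable hφ measurable_left.inv h) h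

end SemidirectProduct

/-! ### Actions of the free group that encode sets of integers -/

/-- The disjoint union of the left translation space of the free group on two generators and of
`ℤ × Bool`. -/
inductive FreeGroupSpace : Type
  /-- the points of the free group -/
  | free (g : FreeGroup Bool)
  /-- the points of `ℤ × Bool` -/
  | strip (m : ℤ) (ε : Bool)

namespace FreeGroupSpace

instance : Countable FreeGroupSpace := by
  have : Function.Injective fun c : FreeGroupSpace => match c with
      | free g => (Sum.inl g : FreeGroup Bool ⊕ ℤ × Bool)
      | strip m ε => Sum.inr (m, ε) := by
    rintro (g | ⟨m, ε⟩) (g' | ⟨m', ε'⟩) h <;> simp_all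
  exact this.countable

instance : Nonempty FreeGroupSpace := ⟨free 1⟩

instance : MeasurableSpace FreeGroupSpace := ⊤

instance : DiscreteMeasurableSpace FreeGroupSpace := ⟨fun _ => trivial⟩

open scoped Classical in
/-- The permutations of `FreeGroupSpace` given by a set `S` of integers: the generators act on the
free group by translation, and on `ℤ × Bool` the generator `true` acts as the shift while `false`
flips the second coordinate over the points of `S`. -/
noncomputable def perm (S : Set ℤ) (b : Bool) : Equiv.Perm FreeGroupSpace where
  toFun
    | free g => free (FreeGroup.of b * g)
    | strip m ε => bif b then strip (m + 1) ε else strip m (if m ∈ S then !ε else ε)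
  invFun
    | free g => free ((FreeGroup.of b)⁻¹ * g)
    | strip m ε => bif b then strip (m - 1) ε else strip m (if m ∈ S then !ε else ε)
  left_inv := by
    rintro (g | ⟨m, ε⟩)
    · simp
    · by_cases h : m ∈ S <;> cases b <;> simp [h]
  right_inv := by
    rintro (g | ⟨m, ε⟩)
    · simp
    · by_cases h : m ∈ S <;> cases b <;> simp [h]

/-- The action of the free group on `FreeGroupSpace` given by a set of integers. -/
noncomputable def action (S : Set ℤ) : FreeGroup Bool →* Equiv.Perm FreeGroupSpace :=
  FreeGroup.lift (perm S)

theorem action_of (S : Set ℤ) (b : Bool) : action S (FreeGroup.of b) = perm S b :=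
  FreeGroup.lift_apply_of

theorem action_free (S : Set ℤ) (k g : FreeGroup Bool) :
    action S k (free g) = free (k * g) := by
  induction k using FreeGroup.induction_on generalizing g with
  | C1 => simp
  | of b => rw [action_of]; rfl
  | inv_of b h =>
    rw [map_inv, Equiv.Perm.inv_eq_iff_eq, h, mul_inv_cancel_left]
  | mul k l hk hl => rw [map_mul, Equiv.Perm.mul_apply, hl, hk, mul_assoc]

theorem action_of_true_strip (S : Set ℤ) (m : ℤ) (ε : Bool) :
    action S (FreeGroup.of true) (strip m ε) = strip (m + 1) ε := by
  rw [action_of]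
  rfl

theorem action_pow_strip (S : Set ℤ) (n : ℕ) (m : ℤ) (ε : Bool) :
    action S (FreeGroup.of true ^ n) (strip m ε) = strip (m + n) ε := by
  induction n with
  | zero => simp
  | succ n ih =>
    rw [pow_succ', map_mul, Equiv.Perm.mul_apply, ih, action_of_true_strip]
    push_cast
    rw [add_assoc]

theorem action_of_false_strip_eq_iff (S : Set ℤ) (m : ℤ) (ε : Bool) :
    action S (FreeGroup.of false) (strip m ε) = strip m ε ↔ m ∉ S := by
  rw [action_of]
  by_cases h : m ∈ S <;> simp [perm, h]

/-- The exponent sum in `ℤ` tells the powers apart. -/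
theorem pow_injective : Function.Injective fun n : ℕ => (FreeGroup.of true : FreeGroup Bool) ^ n := by
  intro n n' h
  have := congrArg (FreeGroup.lift fun _ : Bool => Multiplicative.ofAdd (1 : ℤ)) h
  simpa [← ofAdd_nsmul] using this

instance : Infinite (FreeGroup Bool) := Infinite.of_injective _ pow_injective

theorem action_pow_injective (S : Set ℤ) (c : FreeGroupSpace) :
    Function.Injective fun n : ℕ => action S (FreeGroup.of true ^ n) c := by
  intro n n' h
  rcases c with g | ⟨m, ε⟩
  · simp only [action_free, free.injEq] at h
    exact pow_injective (mul_right_cancel h)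
  · simpa only [action_pow_strip, strip.injEq, and_true, add_right_inj, Nat.cast_inj] using h

/-- The power of the shift carries the base point to column `n`, which the other generator fixes
exactly when `n` is not in `S`. Thus `S` is read off from the stabiliser of one point. -/
theorem action_conj_eq_iff (S : Set ℤ) (n : ℕ) :
    action S ((FreeGroup.of true ^ n)⁻¹ * FreeGroup.of false * FreeGroup.of true ^ n)
      (strip 0 false) = strip 0 false ↔ (n : ℤ) ∉ S := by
  rw [map_mul, map_mul, map_inv, Equiv.Perm.mul_apply, Equiv.Perm.mul_apply,
    Equiv.Perm.inv_eq_iff_eq, action_pow_strip, action_of_false_strip_eq_iff, zero_add]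

variable {X : Type*} {S : X → Set ℤ}

variable (S) in
/-- The fibrewise action of the free group given by a field of sets of integers. -/
noncomputable def fibreAction : FreeGroup Bool →* Equiv.Perm (X × FreeGroupSpace) where
  toFun k := Equiv.prodShear (Equiv.refl X) fun x => action (S x) k
  map_one' := by ext p <;> simp
  map_mul' k l := by ext p <;> simp

theorem fibreAction_apply (k : FreeGroup Bool) (x : X) (c : FreeGroupSpace) :
    fibreAction S k (x, c) = (x, action (S x) k c) := rfl

variable [MeasurableSpace X] [StandardBorelSpace X]

theorem measurable_fibreAction (hS : ∀ m, MeasurableSet {x | m ∈ S x}) (k : FreeGroup Bool) :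
    Measurable (fibreAction S k) := by
  classical
  induction k using FreeGroup.induction_on with
  | C1 => simpa using measurable_id
  | of b =>
    refine measurable_from_prod_countable_left fun c => measurable_id.prodMk ?_
    simp only [action_of]
    rcases c with g | ⟨m, ε⟩
    · exact measurable_const
    · cases b with
      | true => exact measurable_const
      | false =>
        have : (fun x => perm (S x) false (strip m ε)) = fun x =>
            if m ∈ S x then strip m !ε else strip m ε := by
          ext x
          by_cases h : m ∈ S x <;> simp [perm, h]
        rw [this]
        exact Measurable.ite (hS m) measurable_const measurable_const
  | inv_of b h =>
    rw [map_inv]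
    intro s hs
    -- A Borel bijection of a standard Borel space has a Borel inverse.
    have := (h.measurableEmbedding (fibreAction S (FreeGroup.of b)).injective).measurableSet_image.2 hs
    rwa [Equiv.image_eq_preimage_symm] at this
  | mul k l hk hl =>
    rw [map_mul]
    exact hk.comp hl

end FreeGroupSpace

/-! ### The group of lamps and its subgroups -/

namespace FreeGroupSpace

instance : MeasurableSpace (FreeGroup Bool) := ⊤

instance : DiscreteMeasurableSpace (FreeGroup Bool) := ⟨fun _ => trivial⟩

variable {X : Type u}

/-- The action of the free group on the finitely supported functions `X × FreeGroupSpace → ZMod 2`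
given by a field of sets of integers. -/
noncomputable def mulAut (S : X → Set ℤ) :
    FreeGroup Bool →* MulAut (Multiplicative (X × FreeGroupSpace →₀ ZMod 2)) where
  toFun k := AddEquiv.toMultiplicative (Finsupp.domCongr (fibreAction S k))
  map_one' := by
    ext f : 1
    refine congrArg Multiplicative.ofAdd ?_
    simp only [map_one]
    exact Finsupp.equivMapDomain_refl _
  map_mul' k l := by
    ext f : 1
    refine congrArg Multiplicative.ofAdd ?_
    simp only [map_mul]
    exact Finsupp.equivMapDomain_trans _ _ _

theorem toAdd_mulAut_apply (S : X → Set ℤ) (k : FreeGroup Bool)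
    (f : Multiplicative (X × FreeGroupSpace →₀ ZMod 2)) (z : X × FreeGroupSpace) :
    (mulAut S k f).toAdd (fibreAction S k z) = f.toAdd z := by
  change Finsupp.equivMapDomain _ _ _ = _
  rw [Finsupp.equivMapDomain_apply, Equiv.symm_apply_apply]

/-- The generalised wreath product of `ZMod 2` and the free group. -/
abbrev Lamp (S : X → Set ℤ) : Type u :=
  Multiplicative (X × FreeGroupSpace →₀ ZMod 2) ⋊[mulAut S] FreeGroup Bool

/-- The subgroup of elements whose lamps are supported over the class of a point. -/
def lampSubgroup (S : X → Set ℤ) (R : Setoid X) (x : X) : Subgroup (Lamp S) where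
  carrier := {h | ∀ z, h.left.toAdd z ≠ 0 → R x z.1}
  one_mem' z hz := absurd rfl hz
  mul_mem' {g h} hg hh z hz := by
    by_cases hgz : g.left.toAdd z = 0
    · obtain ⟨w, rfl⟩ := (fibreAction S g.right).surjective z
      refine hh w fun hw => hz ?_
      rw [SemidirectProduct.mul_left, toAdd_mul, Finsupp.add_apply, toAdd_mulAut_apply, hgz, hw,
        add_zero]
    · exact hg z hgz
  inv_mem' {g} hg z hz := by
    obtain ⟨w, rfl⟩ := (fibreAction S g.right⁻¹).surjective z
    refine hg w fun hw => hz ?_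
    rw [SemidirectProduct.inv_left, toAdd_mulAut_apply, toAdd_inv, Finsupp.neg_apply, hw, neg_zero]

variable {S : X → Set ℤ} {R : Setoid X}

theorem lampSubgroup_congr {x y : X} (h : R x y) : lampSubgroup S R x = lampSubgroup S R y := by
  ext g
  exact ⟨fun hg z hz => R.trans (R.symm h) (hg z hz), fun hg z hz => R.trans h (hg z hz)⟩

theorem inr_mem_lampSubgroup (x : X) (k : FreeGroup Bool) :
    (SemidirectProduct.inr k : Lamp S) ∈ lampSubgroup S R x :=
  fun _ hz => absurd rfl hz

variable (S) in
/-- The element of the group of lamps with a single lamp lit. -/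
noncomputable def lamp (z : X × FreeGroupSpace) : Lamp S :=
  SemidirectProduct.inl (Multiplicative.ofAdd (Finsupp.single z 1))

theorem lamp_mem_lampSubgroup (x : X) (c : FreeGroupSpace) :
    lamp S (x, c) ∈ lampSubgroup S R x := by
  intro z hz
  have : (x, c) = z := by
    by_contra h
    exact hz (Finsupp.single_eq_of_ne' h)
  exact this ▸ R.refl x

theorem mulAut_ofAdd_single (k : FreeGroup Bool) (z : X × FreeGroupSpace) :
    mulAut S k (Multiplicative.ofAdd (Finsupp.single z 1)) =
      Multiplicative.ofAdd (Finsupp.single (fibreAction S k z) 1) :=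
  congrArg Multiplicative.ofAdd (Finsupp.equivMapDomain_single _ _ _)

theorem lamp_conj_left (h : Lamp S) (z : X × FreeGroupSpace) :
    (lamp S z * h * (lamp S z)⁻¹).left = Multiplicative.ofAdd (Finsupp.single z 1) * h.left *
      (Multiplicative.ofAdd (Finsupp.single (fibreAction S h.right z) 1))⁻¹ := by
  rw [lamp, ← map_inv, SemidirectProduct.mul_left, SemidirectProduct.mul_left,
    SemidirectProduct.mul_right, SemidirectProduct.right_inl, SemidirectProduct.left_inl,
    SemidirectProduct.left_inl, map_one, MulAut.one_apply, one_mul, map_inv, mulAut_ofAdd_single]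

/-- Conjugation by `k` moves a lit lamp from `z` to its image. Fixed points thus become commutation
relations, which injective homomorphisms preserve and reflect. -/
theorem inr_commute_lamp_iff (k : FreeGroup Bool) (z : X × FreeGroupSpace) :
    Commute (SemidirectProduct.inr k : Lamp S) (lamp S z) ↔ fibreAction S k z = z := by
  rw [commute_iff_eq, ← mul_inv_eq_iff_eq_mul, ← map_inv, lamp, ← SemidirectProduct.inl_aut,
    SemidirectProduct.inl_inj, mulAut_ofAdd_single, Multiplicative.ofAdd.injective.eq_iff,
    Finsupp.single_left_inj one_ne_zero]

theorem countable_lampSubgroup (hR : ∀ x, {y | R y x}.Countable) (x : X) :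
    (lampSubgroup S R x : Set (Lamp S)).Countable := by
  have hZ : {z : X × FreeGroupSpace | R x z.1}.Countable := by
    refine (((hR x).prod (Set.countable_univ (α := FreeGroupSpace)))).mono ?_
    exact fun z hz => ⟨R.symm hz, trivial⟩
  have := hZ.to_subtype
  have := (Finsupp.supportedEquivFinsupp (M := ZMod 2) (R := ZMod 2)
    {z : X × FreeGroupSpace | R x z.1}).injective.countable
  have hN : ((Finsupp.supported (ZMod 2) (ZMod 2) {z : X × FreeGroupSpace | R x z.1} :
      Submodule _ _) : Set (X × FreeGroupSpace →₀ ZMod 2)).Countable := Set.to_countable _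
  refine Set.MapsTo.countable_of_injOn (f := fun h : Lamp S => (h.left.toAdd, h.right))
    (t := _ ×ˢ Set.univ) (fun h hh => ⟨?_, trivial⟩) ?_ (hN.prod Set.countable_univ)
  · exact fun z hz => hh z (Finsupp.mem_support_iff.1 hz)
  · intro h _ h' _ hhh'
    exact SemidirectProduct.ext (congrArg Prod.fst hhh') (congrArg Prod.snd hhh')

/-- A family of functions is infinite if the union of its supports is. -/
theorem _root_.Set.infinite_of_infinite_iUnion_support {α Z : Type*} {s : Set α}
    (f : α → Z →₀ ZMod 2) (h : {z | ∃ a ∈ s, f a z ≠ 0}.Infinite) : s.Infinite := by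
  intro hs
  refine h ((hs.biUnion fun a _ => (f a).support.finite_toSet).subset ?_)
  rintro z ⟨a, ha, hz⟩
  exact Set.mem_biUnion ha (Finsupp.mem_support_iff.2 hz)

/-- A pure lamp configuration is shifted by powers of one generator, whose orbits are all infinite.
An element with nontrivial free part is conjugated by single lamps on the free orbit, where that
part fixes no point. -/
theorem infinite_conj_lampSubgroup (x : X) (h : lampSubgroup S R x) (h1 : h ≠ 1) :
    (Set.range fun g : lampSubgroup S R x => g * h * g⁻¹).Infinite := by
  refine Set.infinite_of_infinite_iUnion_support (fun g => g.1.left.toAdd) ?_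
  obtain ⟨h, hh⟩ := h
  by_cases hk : h.right = 1
  · have hl : h.left.toAdd ≠ 0 := fun hl => h1 (Subtype.ext (SemidirectProduct.ext hl hk))
    obtain ⟨⟨y, c⟩, hz⟩ := Finsupp.ne_iff.1 hl
    have hinj : Function.Injective fun n : ℕ =>
        fibreAction S (FreeGroup.of true ^ n) (y, c) := fun n n' hn =>
      action_pow_injective (S y) c (congrArg Prod.snd hn)
    refine (Set.infinite_range_of_injective hinj).mono ?_
    rintro _ ⟨n, rfl⟩
    refine ⟨_, ⟨⟨_, inr_mem_lampSubgroup x (FreeGroup.of true ^ n)⟩, rfl⟩, ?_⟩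
    have : SemidirectProduct.inr (FreeGroup.of true ^ n) * h *
        (SemidirectProduct.inr (FreeGroup.of true ^ n))⁻¹ =
        (SemidirectProduct.inl (mulAut S (FreeGroup.of true ^ n) h.left) : Lamp S) := by
      rw [SemidirectProduct.inl_aut, map_inv]
      congr 2
      exact SemidirectProduct.ext rfl hk
    change (SemidirectProduct.inr (FreeGroup.of true ^ n) * h *
        (SemidirectProduct.inr (FreeGroup.of true ^ n))⁻¹ : Lamp S).left.toAdd _ ≠ 0
    rw [this, SemidirectProduct.left_inl, toAdd_mulAut_apply]
    exact hz
  · have hinf : (Set.range fun g : FreeGroup Bool => (x, free g)).Infinite :=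
      Set.infinite_range_of_injective fun g g' hg => free.inj (congrArg Prod.snd hg)
    -- Points already lit in `h` are left out, so that the conjugating lamp cannot be cancelled
    -- there.
    refine (hinf.sdiff h.left.toAdd.support.finite_toSet).mono ?_
    rintro _ ⟨⟨p, rfl⟩, hp⟩
    refine ⟨_, ⟨⟨_, lamp_mem_lampSubgroup x (free p)⟩, rfl⟩, ?_⟩
    have hp0 : h.left.toAdd (x, free p) = 0 := Finsupp.notMem_support_iff.1 hp
    have hne : fibreAction S h.right (x, free p) ≠ (x, free p) := by
      rw [fibreAction_apply, action_free]
      intro h'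
      have := free.inj (congrArg Prod.snd h')
      exact hk (mul_eq_right.1 this)
    change (lamp S (x, free p) * h * (lamp S (x, free p))⁻¹).left.toAdd _ ≠ 0
    rw [lamp_conj_left, toAdd_mul, toAdd_mul, toAdd_inv, toAdd_ofAdd, toAdd_ofAdd,
      Finsupp.add_apply, Finsupp.add_apply, Finsupp.neg_apply, hp0, Finsupp.single_eq_same,
      Finsupp.single_eq_of_ne hne.symm]
    simp

/-- An embedding of the group of lamps determines the set of integers at the base point. -/
theorem mem_iff_not_commute {Γ : Type*} [Group Γ] {x : X} {ψ : lampSubgroup S R x →* Γ}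
    (hψ : Function.Injective ψ) (n : ℕ) :
    (n : ℤ) ∈ S x ↔ ¬ Commute ((ψ ⟨_, inr_mem_lampSubgroup x (FreeGroup.of true)⟩ ^ n)⁻¹ *
      ψ ⟨_, inr_mem_lampSubgroup x (FreeGroup.of false)⟩ *
      ψ ⟨_, inr_mem_lampSubgroup x (FreeGroup.of true)⟩ ^ n)
      (ψ ⟨_, lamp_mem_lampSubgroup x (strip 0 false)⟩) := by
  rw [← map_pow, ← map_inv, ← map_mul, ← map_mul, ← not_iff_not, not_not, commute_iff_eq,
    ← map_mul, ← map_mul, hψ.eq_iff, Subtype.ext_iff]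
  have h := inr_commute_lamp_iff (S := S) ((FreeGroup.of true ^ n)⁻¹ * FreeGroup.of false *
    FreeGroup.of true ^ n) (x, strip 0 false)
  rw [fibreAction_apply, Prod.mk.injEq, eq_self_iff_true, true_and, action_conj_eq_iff,
    commute_iff_eq] at h
  rw [← h]
  simp only [map_mul, map_inv, map_pow]
  rfl

/-- Only countably many of the groups of lamps embed into a given countable group. -/
theorem countable_of_forall_exists_injective
    (hS : ∀ x y, (∀ n : ℕ, (n : ℤ) ∈ S x ↔ (n : ℤ) ∈ S y) → x = y) {Γ : Type*} [Group Γ]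
    [Countable Γ] {A : Set X} (hA : ∀ x ∈ A, ∃ ψ : lampSubgroup S R x →* Γ, Function.Injective ψ) :
    A.Countable := by
  choose! ψ hψ using hA
  refine Set.MapsTo.countable_of_injOn (t := Set.univ) (f := fun x =>
    (ψ x ⟨_, inr_mem_lampSubgroup x (FreeGroup.of true)⟩,
      ψ x ⟨_, inr_mem_lampSubgroup x (FreeGroup.of false)⟩,
      ψ x ⟨_, lamp_mem_lampSubgroup x (strip 0 false)⟩)) (fun _ _ => trivial) ?_ (Set.to_countable _)
  intro x hx y hy hxy
  simp only [Prod.mk.injEq] at hxy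
  refine hS x y fun n => ?_
  rw [mem_iff_not_commute (hψ x hx), mem_iff_not_commute (hψ y hy), hxy.1, hxy.2.1, hxy.2.2]

section Measurable

variable [MeasurableSpace X]

noncomputable instance : MeasurableSpace (Multiplicative (X × FreeGroupSpace →₀ ZMod 2)) :=
  inferInstanceAs (MeasurableSpace (X × FreeGroupSpace →₀ ZMod 2))

instance : MeasurableMul₂ (Multiplicative (X × FreeGroupSpace →₀ ZMod 2)) where
  measurable_mul := measurable_add (M := X × FreeGroupSpace →₀ ZMod 2)

instance : MeasurableInv (Multiplicative (X × FreeGroupSpace →₀ ZMod 2)) where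
  measurable_inv := measurable_neg (G := X × FreeGroupSpace →₀ ZMod 2)

variable [StandardBorelSpace X]

instance [Nonempty X] : StandardBorelSpace (Multiplicative (X × FreeGroupSpace →₀ ZMod 2)) :=
  inferInstanceAs (StandardBorelSpace (X × FreeGroupSpace →₀ ZMod 2))

theorem measurable_mulAut (hS : ∀ m, MeasurableSet {x | m ∈ S x}) (k : FreeGroup Bool) :
    Measurable (mulAut S k) :=
  Finsupp.measurable_equivMapDomain (measurable_fibreAction hS k)

theorem measurableSet_mem_lampSubgroup [Nonempty X] (hR : MeasurableSet {p : X × X | R p.1 p.2}) :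
    MeasurableSet {p : X × Lamp S | p.2 ∈ lampSubgroup S R p.1} := by
  have h := Finsupp.measurableSet_forall_mem_support (Z := X × FreeGroupSpace)
    (P := fun p : X × X × FreeGroupSpace => R p.1 p.2.1)
    (hR.preimage (f := fun p : X × X × FreeGroupSpace => (p.1, p.2.1)) (by fun_prop))
  have hm : Measurable fun p : X × Lamp S => (p.1, p.2.left.toAdd) :=
    measurable_fst.prodMk ((SemidirectProduct.measurable_left (φ := mulAut S)).comp measurable_snd)
  convert hm h using 1
  ext p
  simp only [Set.mem_ofPred_eq, Set.preimage_ofPred_eq, Finsupp.mem_support_iff]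
  rfl

end Measurable

end FreeGroupSpace

/-! ### The diffuse case -/

open DiscreteBorelGroupoid FreeGroupSpace in
/-- Every countable measured equivalence relation on a diffuse standard probability space is the
orbit relation of a genuine icc groupoid. -/
theorem exists_genuine_icc {X : Type u} [MeasurableSpace X] [StandardBorelSpace X]
    (μ : Measure X) [IsProbabilityMeasure μ] {R : Setoid X} (hR : IsCountableMeasuredRel R μ)
    (hErg : IsErgodicRel R μ) (hμ : ∀ x : X, μ {x} = 0) :
    ∃ 𝒢 : DiscreteMeasuredGroupoid X μ,
      𝒢.orbitRel = R ∧ 𝒢.IsErgodicGenuine μ ∧ 𝒢.IsICC μ := by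
  have : Nonempty X := μ.nonempty_of_neZero
  obtain ⟨f, hf, hfinj⟩ := MeasurableSpace.measurable_injection_nat_bool_of_countablySeparated X
  -- Only membership of natural numbers is used for decoding; negative integers merely repeat the
  -- bit at `0`.
  let S : X → Set ℤ := fun x => {m | f x m.toNat = true}
  have hS : ∀ m, MeasurableSet {x | m ∈ S x} := fun m =>
    (measurable_pi_iff.1 hf m.toNat) (measurableSet_singleton true)
  have hSsep : ∀ x y, (∀ n : ℕ, (n : ℤ) ∈ S x ↔ (n : ℤ) ∈ S y) → x = y := fun x y h =>
    hfinj (funext fun n => Bool.eq_iff_iff.2 (by simpa [S] using h n))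
  have := SemidirectProduct.measurableMul₂ (measurable_mulAut hS)
  have := SemidirectProduct.measurableInv (measurable_mulAut hS)
  have hD := measurableSet_mem_lampSubgroup (S := S) hR.measurableSet_graph
  have hDR : ∀ x y, R x y → lampSubgroup S R x = lampSubgroup S R y :=
    fun x y h => lampSubgroup_congr h
  have hDc := countable_lampSubgroup (S := S) hR.countable_class
  let 𝒢 := ofSubgroups hR.toIsCountableBorelRel (lampSubgroup S R) hD hDR hDc
  have hrel : 𝒢.orbitRel = R := orbitRel_ofSubgroups hR.toIsCountableBorelRel hD hDR hDc
  refine ⟨⟨𝒢, fun A hA => sMeas_eq_zero_iff_tMeas_eq_zero 𝒢 (hrel ▸ hR) hA⟩, hrel,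
    ⟨?_, ?_, fun h => ?_⟩, ?_⟩
  · exact hrel.symm ▸ hErg
  · refine not_isIsoToRel_ofSubgroups hR.toIsCountableBorelRel hD hDR hDc μ fun x =>
      ⟨⟨_, inr_mem_lampSubgroup x (FreeGroup.of true)⟩, fun h => ?_⟩
    exact FreeGroup.of_ne_one true (congrArg (fun g => g.1.right) h)
  · obtain ⟨Γ, _, _, A, hA, hψ⟩ := exists_injective_hom_of_isIsoToTransformation hR.toIsCountableBorelRel hD hDR hDc μ h
    have hAc := countable_of_forall_exists_injective hSsep hψ
    have hA0 : μ A = 0 := (measure_null_iff_singleton hAc).2 fun x _ => hμ x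
    have := measure_union_le (μ := μ) A Aᶜ
    rw [Set.union_compl_self, hA, hA0, measure_univ] at this
    simp at this
  · exact isICC_ofSubgroups hR.toIsCountableBorelRel hD hDR hDc μ infinite_conj_lampSubgroup

/-! ### The atomic case -/

/-- In an ergodic relation, the class of an atom is conull and consists of atoms. -/
theorem IsErgodicRel.class_of_atom {X : Type u} [MeasurableSpace X] [MeasurableSingletonClass X]
    {μ : Measure X} {R : Setoid X} (hR : IsCountableMeasuredRel R μ) (hErg : IsErgodicRel R μ)
    {x : X} (hx : μ {x} ≠ 0) :
    μ {y | R y x}ᶜ = 0 ∧ ∀ y, R y x → μ {y} ≠ 0 := by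
  constructor
  · have hinv : relSaturation R {y | R y x} = {y | R y x} := by
      ext y
      exact ⟨fun ⟨z, hz, hyz⟩ => R.trans hyz hz, fun hy => ⟨y, hy, R.refl y⟩⟩
    refine (hErg _ (hR.countable_class x).measurableSet (Filter.EventuallyEq.of_eq hinv)).resolve_left fun h => hx ?_
    exact measure_mono_null (t := {y | R y x}) (Set.singleton_subset_iff.2 (R.refl x)) h
  · intro y hy h
    refine hx (measure_mono_null ?_ (hR.saturation_null {y} (measurableSet_singleton y) h))
    exact Set.singleton_subset_iff.2 ⟨y, rfl, R.symm hy⟩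

/-- A group structure on the set of units makes it act simply transitively on itself, so that any
two units are joined by a unique translation. -/
theorem exists_commGroup_of_countable (A : Type u) [Countable A] [Nonempty A] :
    Nonempty (CommGroup A) := by
  rcases finite_or_infinite A with h | h
  · have : NeZero (Nat.card A) := ⟨Nat.card_pos.ne'⟩
    exact ⟨((Finite.equivFin A).trans Multiplicative.ofAdd).commGroup⟩
  · obtain ⟨h⟩ := nonempty_denumerable A
    exact ⟨((Denumerable.equiv₂ A ℤ).trans Multiplicative.ofAdd).commGroup⟩

namespace DiscreteBorelGroupoid

variable {X Y : Type u} [MeasurableSpace X] [MeasurableSpace Y]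

/-- When every unit has positive measure, the null-set condition in an isomorphism becomes vacuous
and only the algebra remains. -/
theorem sMeas_eq_zero_iff_eq_empty [MeasurableSingletonClass X] (𝒢 : DiscreteBorelGroupoid X)
    {μ : Measure X} (hμ : ∀ x, μ {x} ≠ 0) (E : Set 𝒢.Arrow) : 𝒢.sMeas μ E = 0 ↔ E = ∅ := by
  refine ⟨fun h => Set.eq_empty_iff_forall_notMem.2 fun g hg => hμ (𝒢.s g) ?_, ?_⟩
  · refine le_antisymm ?_ zero_le
    rw [← h, sMeas, ← lintegral_indicator_one (measurableSet_singleton _)]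
    refine lintegral_mono fun x => ?_
    by_cases hx : x = 𝒢.s g
    · subst hx
      have : (1 : ℕ∞) ≤ {k ∈ E | 𝒢.s k = 𝒢.s g}.encard :=
        Set.one_le_encard_iff_nonempty.2 ⟨g, hg, rfl⟩
      simpa using (ENat.toENNReal_le (m := 1)).2 this
    · simp [hx]
  · rintro rfl
    simp [sMeas]

theorem sMeas_singleton_eq_zero (𝒢 : DiscreteBorelGroupoid X) {μ : Measure X} (g : 𝒢.Arrow)
    (h : μ {𝒢.s g} = 0) : 𝒢.sMeas μ {g} = 0 := by
  refine lintegral_eq_zero_of_ae_eq_zero ?_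
  filter_upwards [measure_eq_zero_iff_ae_notMem.1 h] with x hx
  have : {k ∈ ({g} : Set 𝒢.Arrow) | 𝒢.s k = x} = ∅ := by
    ext k
    simp only [Set.mem_ofPred_eq, Set.mem_singleton_iff, Set.mem_empty_iff_false, iff_false,
      not_and]
    rintro rfl rfl
    exact hx rfl
  simp only [this, Set.encard_empty, ENat.toENNReal_zero, Pi.zero_apply]

theorem comap_singleton {A : Set X} (hA : MeasurableSet A) (μ : Measure X) (x : A) :
    μ.comap Subtype.val {x} = μ {x.1} := by
  rw [comap_subtype_coe_apply hA, Set.image_singleton]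

theorem countable_arrow_restrict (𝒢 : DiscreteBorelGroupoid X) {A : Set X} (hA : MeasurableSet A)
    (hAc : A.Countable) : Countable (𝒢.restrict A hA).Arrow := by
  have : (⋃ x ∈ A, 𝒢.s ⁻¹' {x}).Countable := hAc.biUnion fun x _ => 𝒢.countable_s x
  exact (this.mono (s₁ := {g | 𝒢.s g ∈ A ∧ 𝒢.t g ∈ A}) fun g hg =>
    Set.mem_biUnion hg.1 rfl).to_subtype

theorem measurable_of_countable_arrow (𝒢 : DiscreteBorelGroupoid X) [Countable 𝒢.Arrow]
    {β : Type*} [MeasurableSpace β] (f : 𝒢.Arrow → β) : Measurable f :=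
  measurable_of_countable f

/-- An algebraic isomorphism between groupoids with countable unit spaces is an isomorphism of
measured groupoids if all units have positive measure. -/
theorem isomorphic_of_countable [MeasurableSingletonClass X] [MeasurableSingletonClass Y]
    [Countable Y] {𝒢 : DiscreteBorelGroupoid X} {ℋ : DiscreteBorelGroupoid Y} {μ : Measure X}
    {ν : Measure Y} {A : Set X} (hAc : A.Countable) (hμA : μ Aᶜ = 0) (hμ : ∀ x ∈ A, μ {x} ≠ 0)
    (hν : ∀ y, ν {y} ≠ 0) (e : (𝒢.restrict A hAc.measurableSet).Arrow ≃ ℋ.Arrow)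
    (he : ∀ g h : (𝒢.restrict A hAc.measurableSet).Arrow, 𝒢.s g.1 = 𝒢.t h.1 ↔ ℋ.s (e g) = ℋ.t (e h))
    (hmul : ∀ g h (hgh : (𝒢.restrict A hAc.measurableSet).s g =
      (𝒢.restrict A hAc.measurableSet).t h), e ((𝒢.restrict A hAc.measurableSet).mul g h hgh) =
      ℋ.mul (e g) (e h) ((he g h).1 (Subtype.ext_iff.1 hgh)))
    (hinv : ∀ g, e ((𝒢.restrict A hAc.measurableSet).inv g) = ℋ.inv (e g)) :
    Isomorphic 𝒢 μ ℋ ν := by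
  have := 𝒢.countable_arrow_restrict hAc.measurableSet hAc
  have := ℋ.countable_arrow_restrict MeasurableSet.univ Set.countable_univ
  let e' : (𝒢.restrict A hAc.measurableSet).Arrow ≃ᵐ (ℋ.restrict Set.univ MeasurableSet.univ).Arrow :=
    { toFun := fun g => ⟨e g, trivial, trivial⟩
      invFun := fun h => e.symm h.1
      left_inv := fun g => e.symm_apply_apply g
      right_inv := fun h => Subtype.ext (e.apply_symm_apply h.1)
      measurable_toFun := measurable_of_countable_arrow _ _
      measurable_invFun := measurable_of_countable_arrow _ _ }
  refine ⟨A, hAc.measurableSet, Set.univ, MeasurableSet.univ, hμA, by simp, ⟨e', ?_, ?_, ?_⟩, ?_⟩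
  · intro g h
    exact ⟨fun hgh => Subtype.ext ((he g h).1 (congrArg Subtype.val hgh)),
      fun hgh => Subtype.ext ((he g h).2 (congrArg Subtype.val hgh))⟩
  · exact fun g h hgh => Subtype.ext (hmul g h hgh)
  · exact fun g => Subtype.ext (hinv g)
  · intro E _
    rw [sMeas_eq_zero_iff_eq_empty, sMeas_eq_zero_iff_eq_empty, Set.image_eq_empty]
    · intro y
      rw [comap_singleton MeasurableSet.univ]
      exact hν y
    · intro x
      rw [comap_singleton hAc.measurableSet]
      exact hμ x x.2

open CategoryTheory in
/-- The groupoid as a category: a morphism from `x` to `y` is an arrow with source `x` and target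
`y`. -/
@[reducible]
def toGroupoid (𝒢 : DiscreteBorelGroupoid X) : Groupoid X where
  Hom x y := {g : 𝒢.Arrow // 𝒢.s g = x ∧ 𝒢.t g = y}
  id x := ⟨𝒢.one x, 𝒢.s_one x, 𝒢.t_one x⟩
  comp f g := ⟨𝒢.mul g.1 f.1 (g.2.1.trans f.2.2.symm), (𝒢.s_mul _ _ _).trans f.2.1,
    (𝒢.t_mul _ _ _).trans g.2.2⟩
  id_comp := by
    rintro _ _ ⟨g, rfl, rfl⟩
    exact Subtype.ext (𝒢.mul_one g)
  comp_id := by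
    rintro _ _ ⟨g, rfl, rfl⟩
    exact Subtype.ext (𝒢.one_mul g)
  assoc f g h := Subtype.ext (𝒢.mul_assoc h.1 g.1 f.1 _ _).symm
  inv f := ⟨𝒢.inv f.1, (𝒢.s_inv _).trans f.2.2, (𝒢.t_inv _).trans f.2.1⟩
  inv_comp := by
    rintro _ _ ⟨g, rfl, rfl⟩
    exact Subtype.ext (𝒢.mul_inv g)
  comp_inv := by
    rintro _ _ ⟨g, rfl, rfl⟩
    exact Subtype.ext (𝒢.inv_mul g)

open CategoryTheory in
/-- A groupoid that is transitive on a countable conull set of atoms is isomorphic to a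
transformation groupoid. -/
theorem isIsoToTransformation_of_transitive [StandardBorelSpace X] {μ : Measure X}
    [IsProbabilityMeasure μ] (𝒢 : DiscreteBorelGroupoid X) (x : X)
    (hc : {y | 𝒢.orbitRel y x}.Countable) (hconull : μ {y | 𝒢.orbitRel y x}ᶜ = 0)
    (hpos : ∀ y, 𝒢.orbitRel y x → μ {y} ≠ 0) : 𝒢.IsIsoToTransformation μ := by
  let A : Set X := {y | 𝒢.orbitRel y x}
  have hA : MeasurableSet A := hc.measurableSet
  have : Countable A := hc.to_subtype
  have : Nonempty A := ⟨⟨x, 𝒢.orbitRel.refl x⟩⟩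
  have : StandardBorelSpace A := hA.standardBorel
  obtain ⟨_⟩ := exists_commGroup_of_countable A
  let := 𝒢.toGroupoid
  let Λ := End x
  have hp : ∀ a : A, Nonempty (x ⟶ a.1) := fun a => by
    obtain ⟨g, hgt, hgs⟩ := a.2
    exact ⟨⟨g, hgs, hgt⟩⟩
  let p : ∀ a : A, x ⟶ a.1 := fun a => (hp a).some
  have : Countable Λ := ((𝒢.countable_s x).mono (s₁ := {g | 𝒢.s g = x ∧ 𝒢.t g = x})
    fun g hg => hg.1).to_subtype
  -- The acting group is `Λ × A`: the factor `A` translates the units, and `Λ` acts trivially and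
  -- supplies the isotropy.
  let := MulAction.compHom A (MonoidHom.snd Λ A)
  let : MeasurableSpace (Λ × A) := ⊤
  have : DiscreteMeasurableSpace (Λ × A) := ⟨fun _ => trivial⟩
  have : MeasurableConstSMul (Λ × A) A := ⟨fun c => measurable_of_countable _⟩
  have hν : ∀ a : A, μ.comap Subtype.val {a} ≠ 0 := fun a => by
    rw [comap_singleton hA]
    exact hpos a a.2
  have hprob : IsProbabilityMeasure (μ.comap (Subtype.val : A → X)) := ⟨by
    rw [comap_subtype_coe_apply hA, Set.image_univ, Subtype.range_coe]
    exact (prob_compl_eq_zero_iff hA).1 hconull⟩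
  refine ⟨Λ × A, inferInstance, inferInstance, inferInstance, inferInstance, A, inferInstance,
    inferInstance, μ.comap Subtype.val, hprob, inferInstance, inferInstance, fun c => ?_, ?_⟩
  · refine ⟨measurable_of_countable _, fun E hE => ?_⟩
    have : E = ∅ := Set.eq_empty_iff_forall_notMem.2 fun a ha =>
      hν a (measure_mono_null (Set.singleton_subset_iff.2 ha) hE)
    simp [this]
  · let Φ : ∀ a b : A, (a.1 ⟶ b.1) → A × (Λ × A) := fun a b f =>
      (a, ((p a ≫ f ≫ Groupoid.inv (p b) : x ⟶ x), b / a))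
    let F : (𝒢.restrict A hA).Arrow → A × (Λ × A) := fun g =>
      Φ ⟨𝒢.s g.1, g.2.1⟩ ⟨𝒢.t g.1, g.2.2⟩ ⟨g.1, rfl, rfl⟩
    let arr : ∀ a b : A, (a.1 ⟶ b.1) → (𝒢.restrict A hA).Arrow := fun a b f =>
      ⟨f.1, f.2.1.symm ▸ a.2, f.2.2.symm ▸ b.2⟩
    have harr : ∀ g, ∃ a b f, g = arr a b f := fun g =>
      ⟨⟨𝒢.s g.1, g.2.1⟩, ⟨𝒢.t g.1, g.2.2⟩, ⟨g.1, rfl, rfl⟩, rfl⟩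
    have hF : ∀ a b f, F (arr a b f) = Φ a b f := by
      rintro ⟨a, ha⟩ ⟨b, hb⟩ ⟨g, (hs : 𝒢.s g = a), (ht : 𝒢.t g = b)⟩
      subst hs ht
      rfl
    have hbij : Function.Bijective F := by
      constructor
      · intro g g' h
        obtain ⟨a, b, f, rfl⟩ := harr g
        obtain ⟨a', b', f', rfl⟩ := harr g'
        rw [hF, hF] at h
        obtain ⟨rfl, h⟩ := Prod.mk.inj h
        obtain ⟨h, h'⟩ := Prod.mk.inj h
        obtain rfl := div_left_injective h'
        have : f = f' := by
          rw [cancel_epi (p a)] at h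
          exact (cancel_mono (Groupoid.inv (p b))).1 h
        rw [this]
      · rintro ⟨a, l, c⟩
        refine ⟨arr a (c * a) (Groupoid.inv (p a) ≫ (show x ⟶ x from l) ≫ p (c * a)), ?_⟩
        rw [hF]
        refine Prod.ext rfl (Prod.ext ?_ (mul_div_cancel_right c a))
        simp [Φ]
    refine isomorphic_of_countable hc hconull hpos hν (Equiv.ofBijective F hbij) ?_ ?_ ?_
    · intro g h
      have : (F h).2.2 * (F h).1 = ⟨𝒢.t h.1, h.2.2⟩ := div_mul_cancel _ _
      change _ ↔ (F g).1 = (F h).2.2 * (F h).1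
      rw [this]
      exact ⟨fun hgh => Subtype.ext hgh, fun hgh => congrArg Subtype.val hgh⟩
    · intro g h hgh
      obtain ⟨b, c, f, rfl⟩ := harr g
      obtain ⟨a, b', k, rfl⟩ := harr h
      obtain rfl : b = b' := Subtype.ext (f.2.1.symm.trans ((congrArg Subtype.val hgh).trans k.2.2))
      change F (arr a c (k ≫ f)) = ((F (arr a b k)).1, (F (arr b c f)).2 * (F (arr a b k)).2)
      rw [hF, hF, hF]
      refine Prod.ext rfl (Prod.ext ?_ ?_)
      · change _ = (p a ≫ k ≫ Groupoid.inv (p b)) ≫ (p b ≫ f ≫ Groupoid.inv (p c))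
        simp [Φ]
      · exact (div_mul_div_cancel c b a).symm
    · intro g
      obtain ⟨a, b, f, rfl⟩ := harr g
      change F (arr b a (Groupoid.inv f)) =
        ((F (arr a b f)).2.2 * (F (arr a b f)).1, (F (arr a b f)).2⁻¹)
      rw [hF, hF]
      refine Prod.ext ?_ (Prod.ext ?_ ?_)
      · exact (div_mul_cancel b a).symm
      · change _ = Groupoid.inv (p a ≫ f ≫ Groupoid.inv (p b))
        simp [Φ]
      · exact (inv_div b a).symm

end DiscreteBorelGroupoid

open DiscreteBorelGroupoid

/-- An ergodic relation on a space with an atom is of type I. -/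
theorem isErgodicTypeI_of_atom {X : Type u} [MeasurableSpace X] [StandardBorelSpace X]
    {μ : Measure X} {R : Setoid X} (hR : IsCountableMeasuredRel R μ)
    (hErg : IsErgodicRel R μ) {x : X} (hx : μ {x} ≠ 0) :
    IsErgodicTypeI R hR.toIsCountableBorelRel μ := by
  obtain ⟨hconull, hpos⟩ := hErg.class_of_atom hR hx
  have hc := hR.countable_class x
  have : Countable {y | R y x} := hc.to_subtype
  refine ⟨{y | R y x}, ⟨⟨x, R.refl x⟩⟩, inferInstance, inferInstance, inferInstance, ?_⟩
  refine isomorphic_of_countable hc hconull hpos (by simp)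
    { toFun := fun g => ⟨(⟨g.1.1.1, g.2.2⟩, ⟨g.1.1.2, g.2.1⟩), trivial⟩
      invFun := fun p => ⟨⟨(p.1.1.1, p.1.2.1), R.trans p.1.1.2 (R.symm p.1.2.2)⟩, p.1.2.2, p.1.1.2⟩
      left_inv := fun _ => rfl
      right_inv := fun _ => rfl } ?_ ?_ ?_
  · exact fun g h => ⟨fun hgh => Subtype.ext hgh, fun hgh => congrArg Subtype.val hgh⟩
  · exact fun _ _ _ => rfl
  · exact fun _ => rfl

/-- A relation of type I lives on a space with an atom. -/
theorem IsErgodicTypeI.exists_atom {X : Type u} [MeasurableSpace X] [StandardBorelSpace X]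
    {μ : Measure X} {R : Setoid X} {hR : IsCountableBorelRel R}
    (h : IsErgodicTypeI R hR μ) : ∃ x, μ {x} ≠ 0 := by
  obtain ⟨S, ⟨p⟩, _, _, _, A, hA, B, hB, -, hBc, φ, hφ⟩ := h
  have hpB : p ∈ B := by
    have := Measure.count_eq_zero_iff.1 hBc
    rw [Set.compl_empty_iff] at this
    exact this ▸ trivial
  let u : ((ofRel (⊤ : Setoid S) (isCountableBorelRel_top S)).restrict B hB).Arrow :=
    ⟨⟨(p, p), trivial⟩, hpB, hpB⟩
  let g := φ.toEquiv.symm u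
  refine ⟨g.1.1.2, fun hg => ?_⟩
  -- If the source of `g` were a null point, the arrow would be null, and so would its image under
  -- `φ`. No nonempty set of arrows is null for counting measure.
  have h0 := (hφ {g} (measurableSet_singleton g)).1 (sMeas_singleton_eq_zero _ g (by
    rw [comap_singleton hA]
    exact hg))
  rw [sMeas_eq_zero_iff_eq_empty] at h0
  · simp at h0
  · intro y
    rw [comap_singleton hB]
    simp

theorem mainTheorem1 {X : Type u} [MeasurableSpace X] [StandardBorelSpace X]
    (μ : Measure X) [IsProbabilityMeasure μ] (R : Setoid X)
    (hR : IsCountableMeasuredRel R μ) (hErg : IsErgodicRel R μ) :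
    [ ∀ x : X, μ {x} = 0,
      ¬ IsErgodicTypeI R hR.toIsCountableBorelRel μ,
      ∃ 𝒢 : DiscreteMeasuredGroupoid X μ, 𝒢.orbitRel = R ∧ 𝒢.IsErgodicGenuine μ,
      ∃ 𝒢 : DiscreteMeasuredGroupoid X μ,
        𝒢.orbitRel = R ∧ 𝒢.IsErgodicGenuine μ ∧ 𝒢.IsICC μ ].TFAE := by
  tfae_have 1 → 2 := by
    intro h hI
    obtain ⟨x, hx⟩ := hI.exists_atom
    exact hx (h x)
  tfae_have 2 → 1 := fun h x => by_contra fun hx => h (isErgodicTypeI_of_atom hR hErg hx)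
  tfae_have 1 → 4 := exists_genuine_icc μ hR hErg
  tfae_have 4 → 3 := fun ⟨𝒢, h, hg, _⟩ => ⟨𝒢, h, hg⟩
  tfae_have 3 → 1 := by
    rintro ⟨𝒢, rfl, -, -, hT⟩ x
    by_contra hx
    obtain ⟨hconull, hpos⟩ := hErg.class_of_atom hR hx
    exact hT (isIsoToTransformation_of_transitive _ x (hR.countable_class x) hconull hpos)
  tfae_finish
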